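/- Let $\mathcal H=L^2(\mathbb R)$, with inner product conjugate-linear in the first variable, and for $q,p\in\mathbb R$ let $(U_q\psi)(x)=\psi(x-q)$ and $(V_p\psi)(x)=e^{ipx}\psi(x)$. An observable on a measurable space $\Omega$ is a map $E$ from its $\sigma$-algebra to the operators $0\le E(X)\le 1$ on $\mathcal H$ with $E(\Omega)=1$ that is $\sigma$-additive in the weak operator topology. An instrument is a map $X\mapsto I_X$ on $\mathcal B(\mathbb R)$ whose values are positive linear maps on the trace class operators with $0\le\mathrm{tr}[I_X(T)]\le 1$ and $\mathrm{tr}[I_{\mathbb R}(T)]=1$ for all states (positive trace class operators of trace one) $T$, and which is $\sigma$-additive in trace norm; $I_X^*$ is the dual map on bounded operators, $\mathrm{tr}[T\,I_X^*(A)]=\mathrm{tr}[I_X(T)A]$. Let $\phi\in\mathcal H$ be a unit vector and $P_\phi=|\phi\rangle\langle\phi|$. Let $\nu$ be a Borel probability measure on $\mathbb R$, and let $P_\nu$ be the momentum observable $P_\nu(Y)=\mathcal F^{-1}Q_\nu(Y)\mathcal F$, where $(Q_\nu(Y)\psi)(y)=\nu(Y-y)\psi(y)$ and $(\mathcal F\psi)(y)=(2\pi)^{-1/2}\int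 e^{-iyx}\psi(x)\,dx$ is the Fourier--Plancherel transformation. There is exactly one instrument $I^\phi$ such that for all Borel sets $X$ and all $\varphi_1,\varphi_2\in\mathcal H$ the operator $I^\phi_X(|\varphi_1\rangle\langle\varphi_2|)$ is the integral operator on $L^2(\mathbb R)$ with kernel $$K_X^{\varphi_1,\varphi_2}(x,y)=\varphi_1(x)\overline{\varphi_2(y)}\int_X\overline{\phi(x-z)}\,\phi(y-z)\,dz .$$ There is exactly one observable $G$ on $\mathcal B(\mathbb R^2)$ such that $$G(X\times Y)=I^{\phi\,*}_X(P_\nu(Y))\qquad\text{for all } X,Y\in\mathcal B(\mathbb R)$$ (the joint observable of the sequential measurement of $I^\phi$ followed by $P_\nu$). It is a covariant phase space observable, i.e. $U_qV_pG(Z)V_p^*U_q^*=G(Z+(q,p))$ for all $q,p\in\mathbb R$ and $Z\in\mathcal B(\mathbb R^2)$. Moreover, the operator $$T=\int_{\mathbb R} V_x^*P_\phi V_x\,d\nu(x)$$ is a state, and $G=G_T$, i.e. in the weak sense $$G(Z)=\frac1{2\pi}\int_Z U_qV_p\,T\,V_p^*U_q^*\,dq\,dp\qquad\text{for all } Z\in\mathcal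 B(\mathbb R^2).$$ -/

import Mathlib

open MeasureTheory InnerProductSpace Filter Topology
open scoped ENNReal

noncomputable section

namespace QM

/-! ### Trace class operators, states, observables and instruments -/

section Abstract

variable {H : Type*} [NormedAddCommGroup H] [InnerProductSpace ℂ H] [CompleteSpace H]

/-- `T = ∑ₙ |aₙ⟩⟨bₙ|` with `∑ₙ ‖aₙ‖ ‖bₙ‖ < ∞`. -/
def IsNuclearDecomposition (T : H →L[ℂ] H) (a b : ℕ → H) : Prop :=
  Summable (fun n => ‖a n‖ * ‖b n‖) ∧ HasSum (fun n => rankOne ℂ (a n) (b n)) T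

variable (H) in
/-- The trace class operators on the Hilbert space `H`, as the nuclear operators. -/
def traceClass : Submodule ℂ (H →L[ℂ] H) where
  carrier := {T | ∃ a b : ℕ → H, IsNuclearDecomposition T a b}
  zero_mem' := ⟨0, 0, by simp [IsNuclearDecomposition, hasSum_zero]⟩
  add_mem' := by
    rintro S T ⟨a, b, hab, hS⟩ ⟨c, d, hcd, hT⟩
    let e := Equiv.natSumNatEquivNat
    refine ⟨fun n => Sum.elim a c (e.symm n), fun n => Sum.elim b d (e.symm n), ?_, ?_⟩
    · refine (e.symm.summable_iff
        (f := fun s : ℕ ⊕ ℕ => ‖Sum.elim a c s‖ * ‖Sum.elim b d s‖)).2 ?_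
      exact (HasSum.sum (f := fun s : ℕ ⊕ ℕ => ‖Sum.elim a c s‖ * ‖Sum.elim b d s‖)
        (by simpa [Function.comp_def] using hab.hasSum)
        (by simpa [Function.comp_def] using hcd.hasSum)).summable
    · refine (e.symm.hasSum_iff
        (f := fun s : ℕ ⊕ ℕ => rankOne ℂ (Sum.elim a c s) (Sum.elim b d s))).2 ?_
      exact HasSum.sum (f := fun s : ℕ ⊕ ℕ => rankOne ℂ (Sum.elim a c s) (Sum.elim b d s))
        (by simpa [Function.comp_def] using hS) (by simpa [Function.comp_def] using hT)
  smul_mem' := by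
    rintro c T ⟨a, b, hab, hT⟩
    refine ⟨fun n => c • a n, b, ?_, ?_⟩
    · simpa [norm_smul, mul_assoc] using hab.mul_left ‖c‖
    · simpa using hT.const_smul c

/-- The operator `|a⟩⟨b| = a ⟨b, ·⟩` as an element of the trace class. -/
def ketbra (a b : H) : traceClass H :=
  ⟨rankOne ℂ a b, fun n => if n = 0 then a else 0, fun n => if n = 0 then b else 0, by
    refine ⟨summable_of_ne_finset_zero (s := {0}) fun n hn => ?_, ?_⟩
    · have : n ≠ 0 := by simpa using hn
      simp [this]
    · convert hasSum_single (f := fun n : ℕ => rankOne ℂ (if n = 0 then a else 0)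
        (if n = 0 then b else 0)) 0 (fun n hn => by simp [hn]) using 1
      simp⟩

/-- The trace norm, i.e. the infimum of `∑ₙ ‖aₙ‖ ‖bₙ‖` over all decompositions
`T = ∑ₙ |aₙ⟩⟨bₙ|`. -/
def traceNorm (T : traceClass H) : ℝ :=
  sInf {c | ∃ a b : ℕ → H, IsNuclearDecomposition (T : H →L[ℂ] H) a b ∧
    c = ∑' n, ‖a n‖ * ‖b n‖}

/-- The trace `∑ᵢ ⟨eᵢ, T eᵢ⟩` in an orthonormal basis; it is only used for trace class operators,
where the choice of the basis is irrelevant. -/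
def trace (T : H →L[ℂ] H) : ℂ :=
  ∑' i, ⟪(exists_hilbertBasis ℂ H).choose_spec.choose i,
    T ((exists_hilbertBasis ℂ H).choose_spec.choose i)⟫_ℂ

/-- States: positive trace class operators of trace one. -/
def IsState (T : H →L[ℂ] H) : Prop :=
  0 ≤ T ∧ T ∈ traceClass H ∧ trace T = 1

variable (H) in
/-- Observables: effect valued maps on the σ-algebra of `Ω`, normalized, and σ-additive in the
weak operator topology. (The value at nonmeasurable sets is irrelevant and set to `0`, so that
two observables are equal as soon as they agree on measurable sets.) -/
@[ext]
structure Observable (Ω : Type*) [MeasurableSpace Ω] where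
  toFun : Set Ω → H →L[ℂ] H
  not_measurable' : ∀ X, ¬ MeasurableSet X → toFun X = 0
  nonneg' : ∀ X, MeasurableSet X → 0 ≤ toFun X
  le_one' : ∀ X, MeasurableSet X → toFun X ≤ 1
  univ' : toFun Set.univ = 1
  hasSum' : ∀ X : ℕ → Set Ω, (∀ i, MeasurableSet (X i)) → Pairwise (fun i j => Disjoint (X i) (X j)) →
    ∀ f g : H, HasSum (fun i => ⟪f, toFun (X i) g⟫_ℂ) ⟪f, toFun (⋃ i, X i) g⟫_ℂ

instance {Ω : Type*} [MeasurableSpace Ω] : CoeFun (Observable H Ω) (fun _ => Set Ω → H →L[ℂ] H) :=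
  ⟨Observable.toFun⟩

/-- Operations: positive linear maps on the trace class with `0 ≤ tr[Φ(T)] ≤ 1` for all
states `T`. -/
def IsOperation (Φ : traceClass H →ₗ[ℂ] traceClass H) : Prop :=
  (∀ T : traceClass H, 0 ≤ (T : H →L[ℂ] H) → 0 ≤ (Φ T : H →L[ℂ] H)) ∧
  ∀ T : traceClass H, IsState (T : H →L[ℂ] H) →
    0 ≤ (trace (Φ T : H →L[ℂ] H)).re ∧ (trace (Φ T : H →L[ℂ] H)).re ≤ 1

variable (H) in
/-- Instruments on the Borel sets of the real line: operation valued, normalized, and σ-additive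
in the trace norm. (The value at nonmeasurable sets is irrelevant and set to `0`.) -/
@[ext]
structure Instrument where
  toFun : Set ℝ → traceClass H →ₗ[ℂ] traceClass H
  not_measurable' : ∀ X, ¬ MeasurableSet X → toFun X = 0
  isOperation' : ∀ X, MeasurableSet X → IsOperation (toFun X)
  univ' : ∀ T : traceClass H, IsState (T : H →L[ℂ] H) →
    trace (toFun Set.univ T : H →L[ℂ] H) = 1
  tendsto' : ∀ X : ℕ → Set ℝ, (∀ i, MeasurableSet (X i)) →
    Pairwise (fun i j => Disjoint (X i) (X j)) → ∀ T : traceClass H,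
    Tendsto (fun n => traceNorm (toFun (⋃ i, X i) T - ∑ i ∈ Finset.range n, toFun (X i) T))
      atTop (𝓝 0)

instance : CoeFun (Instrument H) (fun _ => Set ℝ → traceClass H →ₗ[ℂ] traceClass H) :=
  ⟨Instrument.toFun⟩

/-- `B = Φ*(A)`, where `Φ*` is the dual of the map `Φ` on the trace class: `B` is the (unique)
bounded operator with `tr[T B] = tr[Φ(T) A]` for all trace class operators `T`. -/
def IsDualImage (Φ : traceClass H →ₗ[ℂ] traceClass H) (A B : H →L[ℂ] H) : Prop :=
  ∀ T : traceClass H, trace ((T : H →L[ℂ] H) * B) = trace ((Φ T : H →L[ℂ] H) * A)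

/-- `G` is the joint observable of the sequential measurement in which the instrument `I` is
followed by the observable `P`: `G(X × Y) = I_X*(P(Y))`. -/
def IsSequentialJoint (I : Instrument H) (P : Observable H ℝ) (G : Observable H (ℝ × ℝ)) : Prop :=
  ∀ X Y : Set ℝ, MeasurableSet X → MeasurableSet Y → IsDualImage (I X) (P Y) (G (X ×ˢ Y))

end Abstract

/-! ### Position and momentum on `L²(ℝ)` -/

/-- The Hilbert space `L²(ℝ)`. -/
abbrev L2 : Type := Lp ℂ 2 (volume : Measure ℝ)

/-- Multiplication by a bounded measurable function. -/
def mulOp (m : ℝ → ℂ) (hm : MemLp m ∞ volume) : L2 →L[ℂ] L2 :=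
  (ContinuousLinearMap.mul ℂ ℂ).holderL volume ∞ 2 2 hm.toLp

lemma mulOp_coeFn (m : ℝ → ℂ) (hm : MemLp m ∞ volume) (f : L2) :
    mulOp m hm f =ᵐ[volume] fun x => m x * f x := by
  have h1 := (ContinuousLinearMap.mul ℂ ℂ).coeFn_holder (r := 2) hm.toLp f
  filter_upwards [h1, hm.coeFn_toLp] with x hx hx'
  simp only [mulOp, ContinuousLinearMap.holderL_apply_apply]
  rw [hx, hx']
  rfl

/-- The position shift `(U_q ψ)(x) = ψ(x - q)`. -/
def shift (q : ℝ) : L2 →L[ℂ] L2 :=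
  (Lp.compMeasurePreservingₗᵢ ℂ (fun x : ℝ => x - q)
    (measurePreserving_sub_right volume q)).toContinuousLinearMap

lemma memLp_boost (p : ℝ) :
    MemLp (fun x : ℝ => Complex.exp (Complex.I * p * x)) ∞ volume := by
  refine memLp_top_of_bound (by fun_prop) 1 (.of_forall fun x => ?_)
  have : Complex.I * p * x = ((p * x : ℝ) : ℂ) * Complex.I := by push_cast; ring
  rw [this, Complex.norm_exp_ofReal_mul_I]

/-- The momentum boost `(V_p ψ)(x) = e^{ipx} ψ(x)`. -/
def boost (p : ℝ) : L2 →L[ℂ] L2 :=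
  mulOp (fun x : ℝ => Complex.exp (Complex.I * p * x)) (memLp_boost p)

/-- `ρ(X - x)`. -/
def smear (ρ : Measure ℝ) (X : Set ℝ) (x : ℝ) : ℝ :=
  ρ.real ((fun t => t + x) ⁻¹' X)

lemma measurable_smear (ρ : Measure ℝ) [IsProbabilityMeasure ρ] {X : Set ℝ}
    (hX : MeasurableSet X) : Measurable (smear ρ X) := by
  have h : MeasurableSet {z : ℝ × ℝ | z.2 + z.1 ∈ X} :=
    (measurable_snd.add measurable_fst) hX
  exact (measurable_measure_prodMk_left (ν := ρ) h).ennreal_toReal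

lemma smear_nonneg (ρ : Measure ℝ) (X : Set ℝ) (x : ℝ) : 0 ≤ smear ρ X x :=
  measureReal_nonneg

lemma smear_le_one (ρ : Measure ℝ) [IsProbabilityMeasure ρ] (X : Set ℝ) (x : ℝ) :
    smear ρ X x ≤ 1 :=
  measureReal_le_one

lemma memLp_smear (ρ : Measure ℝ) [IsProbabilityMeasure ρ] {X : Set ℝ}
    (hX : MeasurableSet X) : MemLp (fun x => (smear ρ X x : ℂ)) ∞ volume := by
  refine memLp_top_of_bound
    (Complex.measurable_ofReal.comp (measurable_smear ρ hX)).aestronglyMeasurable 1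
    (.of_forall fun x => ?_)
  rw [Complex.norm_real, Real.norm_of_nonneg (smear_nonneg ρ X x)]
  exact smear_le_one ρ X x

lemma inner_mulOp (m : ℝ → ℂ) (hm : MemLp m ∞ volume) (f g : L2) :
    ⟪f, mulOp m hm g⟫_ℂ = ∫ x, m x * ⟪f x, g x⟫_ℂ := by
  rw [L2.inner_def]
  refine integral_congr_ae ?_
  filter_upwards [mulOp_coeFn m hm g] with x hx
  rw [hx, ← smul_eq_mul, inner_smul_right]

lemma inner_mulOp_self (m : ℝ → ℝ) (hm : MemLp (fun x => (m x : ℂ)) ∞ volume) (f : L2) :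
    ⟪f, mulOp _ hm f⟫_ℂ = ((∫ x, m x * ‖f x‖ ^ 2 : ℝ) : ℂ) := by
  rw [inner_mulOp, ← integral_complex_ofReal]
  refine integral_congr_ae (.of_forall fun x => ?_)
  simp only [inner_self_eq_norm_sq_to_K]
  push_cast
  rfl

lemma nonneg_of_inner (A : L2 →L[ℂ] L2)
    (h : ∀ f, ∃ r : ℝ, 0 ≤ r ∧ ⟪f, A f⟫_ℂ = r) : 0 ≤ A := by
  rw [ContinuousLinearMap.nonneg_iff_isPositive, ContinuousLinearMap.isPositive_iff_complex]
  intro f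
  obtain ⟨r, hr, h⟩ := h f
  rw [← inner_conj_symm, h]
  simp [hr]

/-- The position observable `Q_ρ`: `(Q_ρ(X) ψ)(x) = ρ(X - x) ψ(x)`. -/
def positionObservable (ρ : Measure ℝ) [IsProbabilityMeasure ρ] : Observable L2 ℝ := by
  classical
  exact
  { toFun := fun X => if hX : MeasurableSet X then mulOp _ (memLp_smear ρ hX) else 0
    not_measurable' := fun X hX => by simp [hX]
    nonneg' := fun X hX => by
      simp only [hX, dite_true]
      refine nonneg_of_inner _ fun f => ⟨_, ?_, inner_mulOp_self _ _ f⟩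
      exact integral_nonneg fun x => mul_nonneg (smear_nonneg ρ X x) (sq_nonneg _)
    le_one' := fun X hX => by
      simp only [hX, dite_true]
      rw [← sub_nonneg]
      have hm : MemLp (fun x => ((1 - smear ρ X x : ℝ) : ℂ)) ∞ volume := by
        refine memLp_top_of_bound (Complex.measurable_ofReal.comp
          (measurable_const.sub (measurable_smear ρ hX))).aestronglyMeasurable 1
          (.of_forall fun x => ?_)
        rw [Complex.norm_real, Real.norm_of_nonneg (sub_nonneg.2 (smear_le_one ρ X x))]
        linarith [smear_nonneg ρ X x]
      have key : (1 : L2 →L[ℂ] L2) - mulOp _ (memLp_smear ρ hX) = mulOp _ hm := by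
        ext1 f
        apply Lp.ext
        filter_upwards [mulOp_coeFn _ (memLp_smear ρ hX) f, mulOp_coeFn _ hm f,
          Lp.coeFn_sub f (mulOp _ (memLp_smear ρ hX) f)] with x h1 h2 h3
        rw [h2]
        simp only [sub_apply, one_apply_eq_self]
        rw [h3, Pi.sub_apply, h1]
        push_cast
        ring
      rw [key]
      refine nonneg_of_inner _ fun f => ⟨_, ?_, inner_mulOp_self _ _ f⟩
      exact integral_nonneg fun x =>
        mul_nonneg (sub_nonneg.2 (smear_le_one ρ X x)) (sq_nonneg _)
    univ' := by
      simp only [MeasurableSet.univ, dite_true]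
      ext1 f
      apply Lp.ext
      filter_upwards [mulOp_coeFn _ (memLp_smear ρ MeasurableSet.univ) f] with x h1
      rw [h1]
      simp [smear]
    hasSum' := fun X hX hd f g => by
      simp only [hX, MeasurableSet.iUnion hX, dite_true, inner_mulOp]
      have hs : ∀ x, HasSum (fun i => smear ρ (X i) x) (smear ρ (⋃ i, X i) x) := by
        intro x
        have hm : ∀ i, MeasurableSet ((fun t => t + x) ⁻¹' X i) :=
          fun i => (measurable_id.add_const x) (hX i)
        have hd' : Pairwise (fun i j => Disjoint ((fun t => t + x) ⁻¹' X i)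
            ((fun t => t + x) ⁻¹' X j)) := fun i j hij => (hd hij).preimage _
        have h1 := measure_iUnion (μ := ρ) hd' hm
        have h2 : ∑' i, ρ ((fun t => t + x) ⁻¹' X i) ≠ ∞ := by
          rw [← h1]; exact measure_ne_top _ _
        unfold smear Measure.real
        rw [Set.preimage_iUnion, h1, ENNReal.tsum_toReal_eq fun i => measure_ne_top _ _]
        exact (ENNReal.summable_toReal h2).hasSum
      refine hasSum_integral_of_dominated_convergence
        (fun i x => smear ρ (X i) x * ‖⟪f x, g x⟫_ℂ‖) ?_ ?_ ?_ ?_ ?_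
      · intro i
        exact (Complex.measurable_ofReal.comp
          (measurable_smear ρ (hX i))).aestronglyMeasurable.mul
          (L2.integrable_inner (𝕜 := ℂ) f g).aestronglyMeasurable
      · intro i
        refine .of_forall fun x => ?_
        rw [norm_mul, Complex.norm_real, Real.norm_of_nonneg (smear_nonneg ρ _ x)]
      · exact .of_forall fun x => ((hs x).mul_right _).summable
      · have : (fun x => ∑' i, smear ρ (X i) x * ‖⟪f x, g x⟫_ℂ‖) =
            fun x => smear ρ (⋃ i, X i) x * ‖⟪f x, g x⟫_ℂ‖ := by
          funext x
          exact ((hs x).mul_right _).tsum_eq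
        rw [this]
        refine (L2.integrable_inner (𝕜 := ℂ) f g).norm.mono'
          ((measurable_smear ρ (MeasurableSet.iUnion hX)).aestronglyMeasurable.mul
            (L2.integrable_inner (𝕜 := ℂ) f g).norm.aestronglyMeasurable) (.of_forall fun x => ?_)
        rw [norm_mul, Real.norm_of_nonneg (smear_nonneg ρ _ x), norm_norm]
        exact mul_le_of_le_one_left (norm_nonneg _) (smear_le_one ρ _ x)
      · refine .of_forall fun x => ?_
        exact ((Complex.hasSum_ofReal).2 (hs x)).mul_right _ }

lemma eLpNorm_dilation (c : ℝ) (hc : 0 < c) (f : ℝ → ℂ) (hf : AEStronglyMeasurable f volume) :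
    eLpNorm (fun x => (√c : ℂ) * f (c * x)) 2 volume = eLpNorm f 2 volume := by
  have hmap := Real.map_volume_mul_left hc.ne'
  have hf' : AEStronglyMeasurable f (Measure.map (c * ·) volume) := by
    rw [hmap]; exact hf.mono_ac Measure.smul_absolutelyContinuous
  have h1 : eLpNorm (fun x => f (c * x)) 2 volume = eLpNorm f 2 (Measure.map (c * ·) volume) :=
    (eLpNorm_map_measure hf' (by fun_prop)).symm
  have h2 := eLpNorm_const_smul (√c : ℂ) (fun x => f (c * x)) 2 (volume : Measure ℝ)
  have h3 : (√c : ℂ) • (fun x => f (c * x)) = fun x => (√c : ℂ) * f (c * x) := by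
    ext x; simp
  rw [h3] at h2
  rw [h2, h1, hmap, eLpNorm_smul_measure_of_ne_top (by simp), smul_eq_mul, ← mul_assoc]
  have h4 : ‖(√c : ℂ)‖ₑ * ENNReal.ofReal |c⁻¹| ^ (1 / (2 : ℝ≥0∞)).toReal = 1 := by
    rw [← ofReal_norm, Complex.norm_real, Real.norm_of_nonneg (Real.sqrt_nonneg _),
      abs_of_pos (inv_pos.2 hc), ENNReal.ofReal_rpow_of_nonneg (inv_pos.2 hc).le ENNReal.toReal_nonneg,
      ← ENNReal.ofReal_mul (Real.sqrt_nonneg _)]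
    have h5 : (1 / (2 : ℝ≥0∞)).toReal = 1 / 2 := by simp
    rw [h5, ← Real.sqrt_eq_rpow, ← Real.sqrt_mul hc.le, mul_inv_cancel₀ hc.ne']
    simp
  rw [h4, one_mul]

lemma quasiMeasurePreserving_mul (c : ℝ) (hc : 0 < c) :
    Measure.QuasiMeasurePreserving (fun x : ℝ => c * x) volume volume :=
  ⟨by fun_prop, by
    rw [Real.map_volume_mul_left hc.ne']; exact Measure.smul_absolutelyContinuous⟩

lemma memLp_dilation (c : ℝ) (hc : 0 < c) (f : L2) :
    MemLp (fun x => (√c : ℂ) * f (c * x)) 2 volume :=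
  ⟨((Lp.aestronglyMeasurable f).comp_quasiMeasurePreserving
      (quasiMeasurePreserving_mul c hc)).const_mul _, by
    rw [eLpNorm_dilation c hc f (Lp.aestronglyMeasurable f)]; exact Lp.eLpNorm_lt_top f⟩

/-- The dilation `ψ ↦ √c ψ(c ·)` as a linear isometry. -/
def dilationₗᵢ (c : ℝ) (hc : 0 < c) : L2 →ₗᵢ[ℂ] L2 where
  toFun f := (memLp_dilation c hc f).toLp
  map_add' f g := by
    apply Lp.ext
    filter_upwards [(memLp_dilation c hc (f + g)).coeFn_toLp,
      (memLp_dilation c hc f).coeFn_toLp, (memLp_dilation c hc g).coeFn_toLp,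
      Lp.coeFn_add (memLp_dilation c hc f).toLp (memLp_dilation c hc g).toLp,
      (quasiMeasurePreserving_mul c hc).ae (Lp.coeFn_add f g)] with x h1 h2 h3 h4 h5
    rw [h1, h4, Pi.add_apply, h2, h3, h5, Pi.add_apply, mul_add]
  map_smul' a f := by
    apply Lp.ext
    filter_upwards [(memLp_dilation c hc (a • f)).coeFn_toLp,
      (memLp_dilation c hc f).coeFn_toLp,
      Lp.coeFn_smul a (memLp_dilation c hc f).toLp,
      (quasiMeasurePreserving_mul c hc).ae (Lp.coeFn_smul a f)] with x h1 h2 h4 h5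
    rw [h1, RingHom.id_apply, h4, Pi.smul_apply, h2, h5, Pi.smul_apply, smul_eq_mul, smul_eq_mul]
    ring
  norm_map' f := by
    change ‖(memLp_dilation c hc f).toLp‖ = ‖f‖
    rw [Lp.norm_toLp, eLpNorm_dilation c hc f (Lp.aestronglyMeasurable f), Lp.norm_def]

lemma dilationₗᵢ_coeFn (c : ℝ) (hc : 0 < c) (f : L2) :
    dilationₗᵢ c hc f =ᵐ[volume] fun x => (√c : ℂ) * f (c * x) :=
  (memLp_dilation c hc f).coeFn_toLp

lemma dilationₗᵢ_inv (c d : ℝ) (hc : 0 < c) (hd : 0 < d) (h : c * d = 1) (f : L2) :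
    dilationₗᵢ c hc (dilationₗᵢ d hd f) = f := by
  apply Lp.ext
  filter_upwards [dilationₗᵢ_coeFn c hc (dilationₗᵢ d hd f),
    (quasiMeasurePreserving_mul c hc).ae (dilationₗᵢ_coeFn d hd f)] with x h1 h2
  rw [h1, h2, ← mul_assoc, ← mul_assoc, mul_comm d c, h, one_mul, ← Complex.ofReal_mul,
    ← Real.sqrt_mul hc.le, h]
  simp

/-- The dilation `ψ ↦ √c ψ(c ·)` as a unitary operator. -/
def dilation (c : ℝ) (hc : 0 < c) : L2 ≃ₗᵢ[ℂ] L2 where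
  toLinearEquiv := LinearEquiv.ofLinearMap (dilationₗᵢ c hc).toLinearMap
    (dilationₗᵢ c⁻¹ (inv_pos.2 hc)).toLinearMap
    (LinearMap.ext fun f => dilationₗᵢ_inv c c⁻¹ hc (inv_pos.2 hc) (mul_inv_cancel₀ hc.ne') f)
    (LinearMap.ext fun f => dilationₗᵢ_inv c⁻¹ c (inv_pos.2 hc) hc (inv_mul_cancel₀ hc.ne') f)
  norm_map' f := (dilationₗᵢ c hc).norm_map f

/-- The unitary Fourier–Plancherel transformation `(Fψ)(y) = (2π)^{-1/2} ∫ e^{-iyx} ψ(x) dx`.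
Mathlib's transform is `∫ e^{-2πiyx} ψ(x) dx`, whence the dilation by `(2π)⁻¹`. -/
def fourierPlancherel : L2 ≃ₗᵢ[ℂ] L2 :=
  (Lp.fourierTransformₗᵢ ℝ ℂ).trans (dilation (2 * Real.pi)⁻¹ (by positivity))

/-- The momentum observable `P_ν`: `P_ν(Y) = ∫ ν(Y - y) dP(y) = F⁻¹ Q_ν(Y) F`, where
`P(Y) = F⁻¹ Q(Y) F` is the canonical momentum observable. -/
def momentumObservable (ν : Measure ℝ) [IsProbabilityMeasure ν] : Observable L2 ℝ where
  toFun Y := fourierPlancherel.symm.toContinuousLinearEquiv.toContinuousLinearMap ∘L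
    positionObservable ν Y ∘L fourierPlancherel.toContinuousLinearEquiv.toContinuousLinearMap
  not_measurable' Y hY := by simp [(positionObservable ν).not_measurable' Y hY]
  nonneg' Y hY := by
    have h := (ContinuousLinearMap.nonneg_iff_isPositive _).1
      ((positionObservable ν).nonneg' Y hY)
    rw [ContinuousLinearMap.nonneg_iff_isPositive, ContinuousLinearMap.isPositive_iff_complex]
    rw [ContinuousLinearMap.isPositive_iff_complex] at h
    intro f
    have e : ⟪fourierPlancherel.symm (positionObservable ν Y (fourierPlancherel f)), f⟫_ℂ =
        ⟪positionObservable ν Y (fourierPlancherel f), fourierPlancherel f⟫_ℂ := by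
      rw [← fourierPlancherel.inner_map_map, fourierPlancherel.apply_symm_apply]
    simpa [e] using h (fourierPlancherel f)
  le_one' Y hY := by
    have h := ContinuousLinearMap.le_def .. |>.1 ((positionObservable ν).le_one' Y hY)
    rw [ContinuousLinearMap.le_def, ContinuousLinearMap.isPositive_iff_complex]
    rw [ContinuousLinearMap.isPositive_iff_complex] at h
    intro f
    have e : ⟪f - fourierPlancherel.symm (positionObservable ν Y (fourierPlancherel f)), f⟫_ℂ =
        ⟪fourierPlancherel f - positionObservable ν Y (fourierPlancherel f),
          fourierPlancherel f⟫_ℂ := by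
      rw [← fourierPlancherel.inner_map_map, map_sub, fourierPlancherel.apply_symm_apply]
    have h' := h (fourierPlancherel f)
    simp only [sub_apply, one_apply_eq_self] at h'
    rw [← e] at h'
    exact h'
  univ' := by
    rw [(positionObservable ν).univ']
    ext1 f
    exact fourierPlancherel.symm_apply_apply f
  hasSum' X hX hd f g := by
    have e : ∀ Y, ⟪f, fourierPlancherel.symm
        (positionObservable ν Y (fourierPlancherel g))⟫_ℂ =
        ⟪fourierPlancherel f, positionObservable ν Y (fourierPlancherel g)⟫_ℂ := by
      intro Y
      rw [← fourierPlancherel.inner_map_map, fourierPlancherel.apply_symm_apply]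
    have h := (positionObservable ν).hasSum' X hX hd (fourierPlancherel f) (fourierPlancherel g)
    simp only [← e] at h
    exact h

/-! ### The instrument `I^φ` and phase space observables -/

/-- `A` is the integral operator on `L²(ℝ)` with kernel `K`. -/
def IsIntegralOperator (A : L2 →L[ℂ] L2) (K : ℝ → ℝ → ℂ) : Prop :=
  ∀ ψ : L2, A ψ =ᵐ[volume] fun x => ∫ y, K x y * ψ y

/-- The kernel
`K_X^{φ₁,φ₂}(x,y) = φ₁(x) conj(φ₂(y)) ∫ χ_X(z) conj(φ(x - z)) φ(y - z) dz`. -/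
def kernel (φ : L2) (X : Set ℝ) (φ₁ φ₂ : L2) (x y : ℝ) : ℂ :=
  φ₁ x * starRingEnd ℂ (φ₂ y) * ∫ z in X, starRingEnd ℂ (φ (x - z)) * φ (y - z)

/-- `I` is the instrument `I^φ`: for all Borel sets `X` and all `φ₁, φ₂`, the operator
`I_X(|φ₁⟩⟨φ₂|)` is the integral operator with kernel `K_X^{φ₁,φ₂}`. -/
def IsPhiInstrument (φ : L2) (I : Instrument L2) : Prop :=
  ∀ X : Set ℝ, MeasurableSet X → ∀ φ₁ φ₂ : L2,
    IsIntegralOperator (I X (ketbra φ₁ φ₂) : L2 →L[ℂ] L2) (kernel φ X φ₁ φ₂)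

/-- `G` is a covariant phase space observable:
`U_q V_p G(Z) V_p* U_q* = G(Z + (q,p))`. -/
def IsCovariantPhaseSpace (G : Observable L2 (ℝ × ℝ)) : Prop :=
  ∀ (q p : ℝ) (Z : Set (ℝ × ℝ)), MeasurableSet Z →
    shift q * boost p * G Z * star (boost p) * star (shift q) =
      G ((fun z => z + (q, p)) '' Z)

/-- `G = G_T`, i.e. `G(Z) = (1/2π) ∫_Z U_q V_p T V_p* U_q* dq dp` for all Borel sets `Z`, the
integral being understood in the weak sense. -/
def IsGeneratedBy (G : Observable L2 (ℝ × ℝ)) (T : L2 →L[ℂ] L2) : Prop :=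
  ∀ Z : Set (ℝ × ℝ), MeasurableSet Z → ∀ f g : L2,
    IntegrableOn (fun z : ℝ × ℝ => ⟪f, (shift z.1 * boost z.2 * T * star (boost z.2) *
      star (shift z.1)) g⟫_ℂ) Z volume ∧
    ⟪f, G Z g⟫_ℂ = (1 / (2 * Real.pi) : ℂ) *
      ∫ z in Z, ⟪f, (shift z.1 * boost z.2 * T * star (boost z.2) * star (shift z.1)) g⟫_ℂ

/-- `T = ∫ V_x* P_φ V_x dν(x)` for a unit vector `φ`, where `P_φ = |φ⟩⟨φ|`; the integrand is
continuous and bounded in the operator norm, and this is a Bochner integral. -/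
def generatingState (φ : L2) (ν : Measure ℝ) : L2 →L[ℂ] L2 :=
  ∫ x, star (boost x) * rankOne ℂ φ φ * boost x ∂ν

end QM

end

noncomputable section

namespace QM

open scoped ComplexOrder

/-! Fix a countable orthonormal basis $(e_k)$ of $L^2(\mathbb R)$ and let $K_k(X)$ be multiplication
by $x\mapsto\int_X\overline{e_k(z)}\,\overline{\phi(x-z)}\,dz$. This is the $k$-th coefficient of
the function $z\mapsto\chi_X(z)\overline{\phi(x-z)}$, so Parseval in $z$ (`hasSum_coef_mul`) shows
that $\sum_k K_k(X)|a\rangle\langle b|K_k(X)^*$ has the required kernel. Hence $I^\phi_X(T)=\sum_k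
K_k(X)TK_k(X)^*$, and the instrument axioms come from the general theory of such sums
(`IsKrausInstrument.instrument`). Uniqueness holds because an operation, though not assumed
continuous, is determined by its values on the $|x\rangle\langle y|$ (`IsOperation.ext_ketbra`):
positivity together with the trace bound controls the tails of a nuclear expansion.

For the joint observable let $W_f(q,p)=(2\pi)^{-1/2}\int e^{-ipx}\overline{\phi(x-q)}f(x)\,dx$. For
integrable $f$ the Fourier transform of $K_k(X)f$ at $p$ is the $k$-th coefficient of $\chi_X
W_f(\cdot,p)$ (`fourierPlancherel_krausOp`). A second use of Parseval therefore gives $\langle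
f,I^{\phi*}_X(P_\nu(Y))f\rangle=\int\nu(Y-p)\int_X|W_f(q,p)|^2\,dq\,dp$. By Tonelli this is the
integral over $X\times Y$ of $\int|W_f(q,p-t)|^2\,d\nu(t)$ (`lintegral_phaseWeight_prod`), and that
density is $\frac1{2\pi}\langle f,U_qV_pTV_p^*U_q^*f\rangle$ (`inner_weyl_generatingState`), because
$T$ is the $\nu$-mixture of the projections onto $V_{-t}\phi$. Density of Schwartz functions removes
the integrability of $f$. So $G_T$, built directly from its density, is a joint observable; it is
the only one by a $\pi$-$\lambda$ argument, and its covariance is translation invariance of Lebesgue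
measure. -/

lemma summable_mul_of_summable_sq {ι : Type*} {f g : ι → ℝ} (hf : ∀ i, 0 ≤ f i)
    (hg : ∀ i, 0 ≤ g i) (hf2 : Summable fun i => f i ^ 2) (hg2 : Summable fun i => g i ^ 2) :
    Summable (fun i => f i * g i) ∧
      ∑' i, f i * g i ≤ √(∑' i, f i ^ 2) * √(∑' i, g i ^ 2) := by
  have h := Real.summable_and_inner_le_Lp_mul_Lq_tsum_of_nonneg
    (Real.HolderConjugate.two_two) hf hg (by simpa using hf2) (by simpa using hg2)
  refine ⟨h.1, ?_⟩
  simpa [Real.sqrt_eq_rpow] using h.2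

/-! ### Nuclear expansions and the trace. -/

section Abstract

variable {H : Type*} [NormedAddCommGroup H] [InnerProductSpace ℂ H]

/-- Cauchy–Schwarz in $\ell^2$, followed by Bessel's inequality for each factor. -/
lemma summable_norm_inner_mul_inner {κ : Type*} (e : HilbertBasis κ ℂ H) (a b : H) :
    Summable (fun j => ‖⟪e j, a⟫_ℂ‖ * ‖⟪b, e j⟫_ℂ‖) ∧
      ∑' j, ‖⟪e j, a⟫_ℂ‖ * ‖⟪b, e j⟫_ℂ‖ ≤ ‖a‖ * ‖b‖ := by
  have hs : ∀ x : H, Summable (fun j => ‖⟪e j, x⟫_ℂ‖ ^ 2) ∧ ∑' j, ‖⟪e j, x⟫_ℂ‖ ^ 2 ≤ ‖x‖ ^ 2 :=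
    fun x => ⟨e.orthonormal.inner_products_summable x, e.orthonormal.tsum_inner_products_le x⟩
  have h := summable_mul_of_summable_sq (fun j => norm_nonneg ⟪e j, a⟫_ℂ)
    (fun j => norm_nonneg ⟪e j, b⟫_ℂ) (hs a).1 (hs b).1
  simp only [norm_inner_symm b]
  refine ⟨h.1, h.2.trans ?_⟩
  gcongr
  · exact Real.sqrt_le_iff.2 ⟨norm_nonneg _, (hs a).2⟩
  · exact Real.sqrt_le_iff.2 ⟨norm_nonneg _, (hs b).2⟩

/-- `T = ∑ᵢ |aᵢ⟩⟨bᵢ|` with `∑ᵢ ‖aᵢ‖ ‖bᵢ‖ < ∞`, over an arbitrary index type. -/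
def NuclearSum {ι : Type*} (a b : ι → H) (T : H →L[ℂ] H) : Prop :=
  Summable (fun i => ‖a i‖ * ‖b i‖) ∧ HasSum (fun i => rankOne ℂ (a i) (b i)) T

variable {ι : Type*} {a b : ι → H} {T : H →L[ℂ] H}

lemma NuclearSum.hasSum_apply (h : NuclearSum a b T) (x : H) :
    HasSum (fun i => ⟪b i, x⟫_ℂ • a i) (T x) :=
  ((ContinuousLinearMap.apply ℂ H x).hasSum h.2 : _)

lemma NuclearSum.hasSum_inner (h : NuclearSum a b T) (x y : H) :
    HasSum (fun i => ⟪x, a i⟫_ℂ * ⟪b i, y⟫_ℂ) ⟪x, T y⟫_ℂ := by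
  have := (innerSL ℂ x).hasSum (h.hasSum_apply y)
  simpa [inner_smul_right, mul_comm] using this

/-- Other index types are needed because the expansions of Kraus sums are indexed by pairs. An
injection into `ℕ` and extension by zero lead back to sequences. -/
lemma NuclearSum.exists_nat [Countable ι] (h : NuclearSum a b T) :
    ∃ a' b' : ℕ → H, IsNuclearDecomposition T a' b' ∧
      ∑' n, ‖a' n‖ * ‖b' n‖ = ∑' i, ‖a i‖ * ‖b i‖ := by
  obtain ⟨f, hf⟩ := Countable.exists_injective_nat ι
  have e1 : ∀ i, Function.extend f a 0 (f i) = a i := fun i => hf.extend_apply _ _ i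
  have e2 : ∀ i, Function.extend f b 0 (f i) = b i := fun i => hf.extend_apply _ _ i
  have e0 : ∀ n, n ∉ Set.range f → Function.extend f a 0 n = 0 := fun n hn =>
    Function.extend_apply' _ _ _ (by simpa using hn)
  have hs : HasSum (fun n => ‖Function.extend f a 0 n‖ * ‖Function.extend f b 0 n‖)
      (∑' i, ‖a i‖ * ‖b i‖) := by
    refine (hf.hasSum_iff (fun n hn => by simp [e0 n hn])).1 ?_
    simpa [Function.comp_def, e1, e2] using h.1.hasSum
  refine ⟨Function.extend f a 0, Function.extend f b 0, ⟨hs.summable, ?_⟩, hs.tsum_eq⟩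
  refine (hf.hasSum_iff (fun n hn => by simp [e0 n hn])).1 ?_
  simpa [Function.comp_def, e1, e2] using h.2

/-- Fubini for the absolutely summable family $\langle e_j,a_i\rangle\langle b_i,e_j\rangle$. Since
the sum over $i$ of $\langle b_i,a_i\rangle$ does not mention the basis, this is also the basis
independence of the trace. -/
lemma NuclearSum.hasSum_diag (h : NuclearSum a b T) {κ : Type*} (e : HilbertBasis κ ℂ H) :
    HasSum (fun j => ⟪e j, T (e j)⟫_ℂ) (∑' i, ⟪b i, a i⟫_ℂ) ∧
      Summable (fun i => ⟪b i, a i⟫_ℂ) := by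
  have hsum : Summable (fun q : ι × κ => ⟪e q.2, a q.1⟫_ℂ * ⟪b q.1, e q.2⟫_ℂ) := by
    refine Summable.of_norm ?_
    simp only [norm_mul]
    refine (summable_prod_of_nonneg fun q => by positivity).2
      ⟨fun i => (summable_norm_inner_mul_inner e (a i) (b i)).1, ?_⟩
    refine Summable.of_nonneg_of_le (fun i => tsum_nonneg fun j => by positivity)
      (fun i => (summable_norm_inner_mul_inner e (a i) (b i)).2) h.1
  have h1 : HasSum (fun i => ⟪b i, a i⟫_ℂ)
      (∑' q : ι × κ, ⟪e q.2, a q.1⟫_ℂ * ⟪b q.1, e q.2⟫_ℂ) := by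
    refine hsum.hasSum.prod_fiberwise fun i => ?_
    simpa [mul_comm] using e.hasSum_inner_mul_inner (b i) (a i)
  have h2 := ((Equiv.prodComm κ ι).hasSum_iff.2 hsum.hasSum).prod_fiberwise
    (g := fun j => ⟪e j, T (e j)⟫_ℂ) fun j => by
      simpa using h.hasSum_inner (e j) (e j)
  exact ⟨by rw [h1.tsum_eq]; exact h2, h1.summable⟩

variable [CompleteSpace H]

lemma NuclearSum.of_summable (h : Summable fun i => ‖a i‖ * ‖b i‖) :
    NuclearSum a b (∑' i, rankOne ℂ (a i) (b i)) :=
  ⟨h, (Summable.of_norm (by simpa using h)).hasSum⟩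

lemma NuclearSum.mul_right (h : NuclearSum a b T) (B : H →L[ℂ] H) :
    NuclearSum a (fun i => star B (b i)) (T * B) := by
  refine ⟨(h.1.mul_left ‖star B‖).of_nonneg_of_le (fun i => by positivity) fun i => ?_, ?_⟩
  · calc ‖a i‖ * ‖star B (b i)‖ ≤ ‖a i‖ * (‖star B‖ * ‖b i‖) := by
          gcongr; exact ContinuousLinearMap.le_opNorm _ _
      _ = _ := by ring
  · have := h.2.mul_right B
    refine this.congr_fun fun i => ?_
    ext x
    simp [ContinuousLinearMap.star_eq_adjoint, ContinuousLinearMap.adjoint_inner_left]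

lemma NuclearSum.mem_traceClass [Countable ι] (h : NuclearSum a b T) : T ∈ traceClass H := by
  obtain ⟨a', b', h', -⟩ := h.exists_nat
  exact ⟨a', b', h'⟩

lemma traceNorm_nonneg (S : traceClass H) : 0 ≤ traceNorm S := by
  refine Real.sInf_nonneg ?_
  rintro c ⟨a, b, -, rfl⟩
  exact tsum_nonneg fun n => by positivity

lemma NuclearSum.traceNorm_le [Countable ι] {S : traceClass H}
    (h : NuclearSum a b (S : H →L[ℂ] H)) : traceNorm S ≤ ∑' i, ‖a i‖ * ‖b i‖ := by
  obtain ⟨a', b', h', e⟩ := h.exists_nat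
  rw [← e]
  refine csInf_le ⟨0, ?_⟩ ⟨a', b', h', rfl⟩
  rintro c ⟨a, b, -, rfl⟩
  exact tsum_nonneg fun n => by positivity

lemma NuclearSum.trace_eq (h : NuclearSum a b T) : trace T = ∑' i, ⟪b i, a i⟫_ℂ :=
  (h.hasSum_diag _).1.tsum_eq

lemma NuclearSum.hasSum_trace_mul (h : NuclearSum a b T) (B : H →L[ℂ] H) :
    HasSum (fun i => ⟪b i, B (a i)⟫_ℂ) (trace (T * B)) := by
  have h' := h.mul_right B
  rw [h'.trace_eq]
  simpa [ContinuousLinearMap.star_eq_adjoint, ContinuousLinearMap.adjoint_inner_left] using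
    (h'.hasSum_diag (exists_hilbertBasis ℂ H).choose_spec.choose).2.hasSum

lemma exists_nuclearSum (S : traceClass H) : ∃ a b : ℕ → H, NuclearSum a b (S : H →L[ℂ] H) := S.2

lemma nuclearSum_ketbra (x y : H) :
    NuclearSum (fun _ : Unit => x) (fun _ => y) (ketbra x y : H →L[ℂ] H) :=
  ⟨Summable.of_finite, hasSum_unique (fun _ : Unit => rankOne ℂ x y)⟩

lemma trace_ketbra_mul (x y : H) (B : H →L[ℂ] H) :
    trace ((ketbra x y : H →L[ℂ] H) * B) = ⟪y, B x⟫_ℂ := by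
  rw [← ((nuclearSum_ketbra x y).hasSum_trace_mul B).tsum_eq]
  simp

lemma hasSum_trace_of_mem (hT : T ∈ traceClass H) {κ : Type*} (e : HilbertBasis κ ℂ H) :
    HasSum (fun j => ⟪e j, T (e j)⟫_ℂ) (trace T) := by
  obtain ⟨a, b, h⟩ := hT
  have h : NuclearSum a b T := h
  rw [h.trace_eq]
  exact (h.hasSum_diag e).1

lemma trace_add {S T : H →L[ℂ] H} (hS : S ∈ traceClass H) (hT : T ∈ traceClass H) :
    trace (S + T) = trace S + trace T := by
  obtain ⟨w, e, -⟩ := exists_hilbertBasis ℂ H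
  refine (hasSum_trace_of_mem ((traceClass H).add_mem hS hT) e).unique ?_
  simpa [inner_add_right] using (hasSum_trace_of_mem hS e).add (hasSum_trace_of_mem hT e)

lemma trace_smul (c : ℂ) (hT : T ∈ traceClass H) : trace (c • T) = c * trace T := by
  obtain ⟨w, e, -⟩ := exists_hilbertBasis ℂ H
  refine (hasSum_trace_of_mem ((traceClass H).smul_mem c hT) e).unique ?_
  simpa [inner_smul_right] using (hasSum_trace_of_mem hT e).mul_left c

omit [CompleteSpace H] in
lemma inner_nonneg_of_nonneg (hT : 0 ≤ T) (x : H) : 0 ≤ ⟪x, T x⟫_ℂ :=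
  ((ContinuousLinearMap.nonneg_iff_isPositive _).1 hT).inner_nonneg_right x

lemma trace_nonneg (hT : 0 ≤ T) (hT' : T ∈ traceClass H) : 0 ≤ trace T := by
  obtain ⟨w, e, -⟩ := exists_hilbertBasis ℂ H
  rw [← (hasSum_trace_of_mem hT' e).tsum_eq]
  exact tsum_nonneg fun j => inner_nonneg_of_nonneg hT _

/-- Extend the unit vector to a Hilbert basis: its diagonal entry is then one of the nonnegative
terms of the trace. -/
lemma inner_le_trace (hT : 0 ≤ T) (hT' : T ∈ traceClass H) {x : H} (hx : ‖x‖ = 1) :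
    ⟪x, T x⟫_ℂ ≤ trace T := by
  have ho : Orthonormal ℂ ((↑) : ({x} : Set H) → H) := by
    refine ⟨?_, ?_⟩
    · rintro ⟨y, rfl⟩; exact hx
    · rintro ⟨y, rfl⟩ ⟨z, rfl⟩ h; exact (h rfl).elim
  obtain ⟨w, e, hw, he⟩ := ho.exists_hilbertBasis_extension
  have hxw : x ∈ w := hw rfl
  have h := hasSum_trace_of_mem hT' e
  have := le_hasSum h ⟨x, hxw⟩ fun j _ => inner_nonneg_of_nonneg hT (e j)
  simpa [he] using this

lemma inner_re_le_trace (hT : 0 ≤ T) (hT' : T ∈ traceClass H) (x : H) :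
    (⟪x, T x⟫_ℂ).re ≤ ‖x‖ ^ 2 * (trace T).re := by
  rcases eq_or_ne x 0 with rfl | hx
  · simp
  have hn : ‖x‖ ≠ 0 := norm_ne_zero_iff.2 hx
  have h := inner_le_trace hT hT' (x := ((‖x‖⁻¹ : ℝ) : ℂ) • x) (by
    rw [norm_smul, Complex.norm_real]; simp [hn])
  have h' := (Complex.le_def.1 h).1
  simp only [map_smul, inner_smul_left, inner_smul_right, Complex.conj_ofReal] at h'
  rw [← mul_assoc, ← Complex.ofReal_mul, Complex.re_ofReal_mul] at h'
  have : 0 < ‖x‖ ^ 2 := by positivity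
  calc (⟪x, T x⟫_ℂ).re = ‖x‖ ^ 2 * (‖x‖⁻¹ * ‖x‖⁻¹ * (⟪x, T x⟫_ℂ).re) := by field_simp
    _ ≤ _ := by gcongr

end Abstract

/-! ### Positivity and the square root criterion for the trace class. -/

section Abstract

variable {H : Type*} [NormedAddCommGroup H] [InnerProductSpace ℂ H]
variable {ι κ : Type*} {a b : ι → H} {T : H →L[ℂ] H}

lemma nonneg_of_forall_inner_nonneg [CompleteSpace H] (h : ∀ x, 0 ≤ ⟪x, T x⟫_ℂ) : 0 ≤ T := by
  rw [ContinuousLinearMap.nonneg_iff_isPositive, ContinuousLinearMap.isPositive_iff_complex]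
  intro x
  obtain ⟨h1, h2⟩ := Complex.nonneg_iff.1 (h x)
  rw [← inner_conj_symm]
  refine ⟨?_, (h1.trans_eq (Complex.conj_re _).symm :)⟩
  apply Complex.ext <;> simp [-inner_conj_symm, ← h2]

lemma eq_of_forall_inner_self {S T : H →L[ℂ] H} (h : ∀ x, ⟪x, S x⟫_ℂ = ⟪x, T x⟫_ℂ) : S = T := by
  have : (S : H →ₗ[ℂ] H) = T := by
    rw [← ext_inner_map]
    intro x
    have := congrArg (starRingEnd ℂ) (h x)
    simpa [inner_conj_symm] using this
  exact ContinuousLinearMap.coe_injective this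

variable [CompleteSpace H]

lemma NuclearSum.nonneg (h : NuclearSum a a T) : 0 ≤ T := by
  refine nonneg_of_forall_inner_nonneg fun x => ?_
  rw [← (h.hasSum_inner x x).tsum_eq]
  refine tsum_nonneg fun i => ?_
  rw [← inner_conj_symm x, Complex.conj_mul']
  exact_mod_cast sq_nonneg ‖⟪a i, x⟫_ℂ‖

lemma NuclearSum.trace_self (h : NuclearSum a a T) : (trace T).re = ∑' i, ‖a i‖ ^ 2 := by
  rw [h.trace_eq]
  simp only [inner_self_eq_norm_sq_to_K]
  norm_cast

/-- With $S=\sqrt T$, applying $S$ to the expansion of $Sx$ in the basis gives $Tx=\sum_j\langle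
Se_j,x\rangle Se_j$, while $\|Se_j\|^2=\langle e_j,Te_j\rangle$ is summable. -/
lemma nuclearSum_sqrt (hT : 0 ≤ T) (e : HilbertBasis κ ℂ H)
    (hs : Summable fun j => (⟪e j, T (e j)⟫_ℂ).re) :
    NuclearSum (fun j => CFC.sqrt T (e j)) (fun j => CFC.sqrt T (e j)) T := by
  set S := CFC.sqrt T with hS
  have hSS : S * S = T := CFC.sqrt_mul_sqrt_self T hT
  have hsa : ∀ x y, ⟪S x, y⟫_ℂ = ⟪x, S y⟫_ℂ := fun x y => by
    have := ((ContinuousLinearMap.nonneg_iff_isPositive _).1 (CFC.sqrt_nonneg T)).isSymmetric x y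
    exact this
  have hn : ∀ j, ‖S (e j)‖ * ‖S (e j)‖ = (⟪e j, T (e j)⟫_ℂ).re := fun j => by
    rw [← hSS, mul_apply_eq_comp, ← hsa, inner_self_eq_norm_sq_to_K, ← pow_two]
    norm_cast
  have h1 : NuclearSum (fun j => S (e j)) (fun j => S (e j))
      (∑' j, rankOne ℂ (S (e j)) (S (e j))) := NuclearSum.of_summable (by simpa [hn] using hs)
  convert h1
  ext x
  refine HasSum.unique ?_ (h1.hasSum_apply x)
  have := S.hasSum (e.hasSum_repr (S x))
  rw [← mul_apply_eq_comp, hSS] at this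
  simpa [e.repr_apply_apply, hsa] using this

lemma mem_traceClass_of_summable [Countable κ] (hT : 0 ≤ T) (e : HilbertBasis κ ℂ H)
    (hs : Summable fun j => (⟪e j, T (e j)⟫_ℂ).re) : T ∈ traceClass H :=
  (nuclearSum_sqrt hT e hs).mem_traceClass

/-! ### Operations are determined by their values on `|x⟩⟨y|` -/

lemma eq_zero_of_trace_eq_zero (hT : 0 ≤ T) (hT' : T ∈ traceClass H) (h : (trace T).re = 0) :
    T = 0 := by
  refine eq_of_forall_inner_self fun x => ?_
  have h1 := inner_re_le_trace hT hT' x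
  obtain ⟨h2, h3⟩ := Complex.nonneg_iff.1 (inner_nonneg_of_nonneg hT x)
  rw [h, mul_zero] at h1
  apply Complex.ext
  · simpa using le_antisymm h1 h2
  · simpa using h3.symm

/-- The axiom speaks of states only, so normalize; a positive operator of trace zero vanishes. -/
lemma IsOperation.trace_re_le {Φ : traceClass H →ₗ[ℂ] traceClass H} (hΦ : IsOperation Φ)
    {S : traceClass H} (hS : 0 ≤ (S : H →L[ℂ] H)) :
    (trace (Φ S : H →L[ℂ] H)).re ≤ (trace (S : H →L[ℂ] H)).re := by
  obtain ⟨h0, him⟩ := Complex.nonneg_iff.1 (trace_nonneg hS S.2)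
  rcases h0.eq_or_lt with h | h
  · have : S = 0 := Subtype.ext (eq_zero_of_trace_eq_zero hS S.2 h.symm)
    simp [this]
  · set t := (trace (S : H →L[ℂ] H)).re with ht
    have htr : trace (S : H →L[ℂ] H) = (t : ℂ) := Complex.ext rfl (by simpa using him.symm)
    have hst : IsState (((t⁻¹ : ℝ) : ℂ) • S : traceClass H).1 := by
      refine ⟨?_, (((t⁻¹ : ℝ) : ℂ) • S : traceClass H).2, ?_⟩
      · refine nonneg_of_forall_inner_nonneg fun x => ?_
        simp only [Submodule.coe_smul, smul_apply, inner_smul_right]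
        exact mul_nonneg (by exact_mod_cast (inv_pos.2 h).le) (inner_nonneg_of_nonneg hS x)
      · simp only [Submodule.coe_smul]
        rw [trace_smul _ S.2, htr, ← Complex.ofReal_mul, inv_mul_cancel₀ h.ne', Complex.ofReal_one]
    have := (hΦ.2 _ hst).2
    rw [map_smul, Submodule.coe_smul, trace_smul _ (Φ S).2, Complex.re_ofReal_mul] at this
    rwa [inv_mul_le_iff₀ h, mul_one] at this

lemma IsOperation.inner_re_le {Φ : traceClass H →ₗ[ℂ] traceClass H} (hΦ : IsOperation Φ)
    {S : traceClass H} (hS : 0 ≤ (S : H →L[ℂ] H)) (x : H) :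
    (⟪x, (Φ S : H →L[ℂ] H) x⟫_ℂ).re ≤ ‖x‖ ^ 2 * (trace (S : H →L[ℂ] H)).re :=
  (inner_re_le_trace (hΦ.1 S hS) (Φ S).2 x).trans
    (mul_le_mul_of_nonneg_left (hΦ.trace_re_le hS) (sq_nonneg _))

lemma exists_nuclearSum_sq (S : traceClass H) : ∃ a b : ℕ → H, NuclearSum a b (S : H →L[ℂ] H) ∧
    (Summable fun n => ‖a n‖ ^ 2) ∧ Summable fun n => ‖b n‖ ^ 2 := by
  obtain ⟨a, b, h1, h2⟩ := exists_nuclearSum S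
  have key : ∀ n, ∃ a' b' : H, rankOne ℂ a' b' = rankOne ℂ (a n) (b n) ∧
      ‖a'‖ ^ 2 = ‖a n‖ * ‖b n‖ ∧ ‖b'‖ ^ 2 = ‖a n‖ * ‖b n‖ := by
    intro n
    rcases eq_or_ne (a n) 0 with ha | ha
    · exact ⟨0, 0, by simp [ha]⟩
    rcases eq_or_ne (b n) 0 with hb | hb
    · exact ⟨0, 0, by simp [hb]⟩
    have ha' : 0 < ‖a n‖ := norm_pos_iff.2 ha
    have hb' : 0 < ‖b n‖ := norm_pos_iff.2 hb
    -- This factor moves weight between the two vectors until both have norm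
    -- $\sqrt{\|a_n\|\|b_n\|}$, leaving $|a_n\rangle\langle b_n|$ unchanged.
    set r := √(‖b n‖ / ‖a n‖) with hr
    have hr0 : 0 < r := Real.sqrt_pos.2 (by positivity)
    have hr2 : r ^ 2 = ‖b n‖ / ‖a n‖ := Real.sq_sqrt (by positivity)
    refine ⟨(r : ℂ) • a n, ((r⁻¹ : ℝ) : ℂ) • b n, ?_, ?_, ?_⟩
    · ext x
      simp only [rankOne_apply, inner_smul_left, Complex.conj_ofReal, smul_smul]
      congr 1
      rw [mul_comm, ← mul_assoc, ← Complex.ofReal_mul, mul_inv_cancel₀ hr0.ne']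
      simp
    · rw [norm_smul, Complex.norm_real, mul_pow, Real.norm_of_nonneg hr0.le, hr2]; field_simp
    · rw [norm_smul, Complex.norm_real, mul_pow, Real.norm_of_nonneg (inv_pos.2 hr0).le, inv_pow,
        hr2]; field_simp
  choose a' b' e na nb using key
  refine ⟨a', b', ⟨?_, ?_⟩, by simpa [na] using h1, by simpa [nb] using h1⟩
  · refine h1.congr fun n => ?_
    have h : ‖a' n‖ = ‖b' n‖ := by
      rw [← abs_norm, ← abs_norm (b' n), ← sq_eq_sq_iff_abs_eq_abs, na, nb]
    rw [← nb n, h, pow_two]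
  · simpa [e] using h2

/-- The two maps agree on every partial sum, so their difference at $S$ is their difference at the
tail. The tail is positive with trace tending to zero, and the quadratic form of the image of a
positive operator is bounded by its trace; no continuity of the maps is used. -/
lemma IsOperation.eq_of_nuclearSum_self {Φ Ψ : traceClass H →ₗ[ℂ] traceClass H}
    (hΦ : IsOperation Φ) (hΨ : IsOperation Ψ)
    (h : ∀ x y, Φ (ketbra x y) = Ψ (ketbra x y)) {c : ℕ → H} {S : traceClass H}
    (hS : NuclearSum c c (S : H →L[ℂ] H)) : Φ S = Ψ S := by
  set R : ℕ → traceClass H := fun N => S - ∑ n ∈ Finset.range N, ketbra (c n) (c n) with hR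
  have hRN : ∀ N, NuclearSum (fun n => c (n + N)) (fun n => c (n + N)) (R N : H →L[ℂ] H) := by
    intro N
    refine ⟨(summable_nat_add_iff N).2 hS.1, ?_⟩
    have := (hasSum_nat_add_iff' (f := fun n => rankOne ℂ (c n) (c n)) N).2 hS.2
    have e : (R N : H →L[ℂ] H) = S - ∑ n ∈ Finset.range N, rankOne ℂ (c n) (c n) := by
      simp only [hR, AddSubgroupClass.coe_sub, AddSubmonoidClass.coe_finsetSum, ketbra]
    rw [e]
    exact this
  have hlim : Tendsto (fun N => ∑' n, ‖c (n + N)‖ ^ 2) atTop (𝓝 0) :=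
    tendsto_sum_nat_add fun n => ‖c n‖ ^ 2
  have hz : ∀ {Ξ : traceClass H →ₗ[ℂ] traceClass H}, IsOperation Ξ → ∀ x,
      Tendsto (fun N => (⟪x, (Ξ (R N) : H →L[ℂ] H) x⟫_ℂ).re) atTop (𝓝 0) := by
    intro Ξ hΞ x
    refine squeeze_zero (fun N => ?_) (fun N => hΞ.inner_re_le (hRN N).nonneg x) ?_
    · exact (Complex.nonneg_iff.1 (inner_nonneg_of_nonneg (hΞ.1 _ (hRN N).nonneg) x)).1
    · have : ∀ N, (trace (R N : H →L[ℂ] H)).re = ∑' n, ‖c (n + N)‖ ^ 2 := fun N =>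
        (hRN N).trace_self
      simpa [this] using hlim.const_mul (‖x‖ ^ 2)
  have hd : ∀ N, Φ S - Ψ S = Φ (R N) - Ψ (R N) := by
    intro N
    simp only [hR, map_sub, map_sum, h]
    abel
  refine Subtype.ext (eq_of_forall_inner_self fun x => ?_)
  have hre : (⟪x, (Φ S : H →L[ℂ] H) x⟫_ℂ).re - (⟪x, (Ψ S : H →L[ℂ] H) x⟫_ℂ).re = 0 := by
    refine tendsto_nhds_unique ?_ ((hz hΦ x).sub (hz hΨ x) |>.trans (by simp))
    refine tendsto_const_nhds.congr fun N => ?_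
    have := congrArg (fun A : traceClass H => (⟪x, (A : H →L[ℂ] H) x⟫_ℂ).re) (hd N)
    simpa [inner_sub_right] using this
  -- Both images are positive, so the imaginary parts vanish and only the real parts had to be
  -- compared.
  have i1 := (Complex.nonneg_iff.1 (inner_nonneg_of_nonneg (hΦ.1 _ hS.nonneg) x)).2
  have i2 := (Complex.nonneg_iff.1 (inner_nonneg_of_nonneg (hΨ.1 _ hS.nonneg) x)).2
  exact Complex.ext (sub_eq_zero.1 hre) (i1.symm.trans i2)

/-- Polarization $|a\rangle\langle b|=\frac14\sum_{k<4}i^k|a+i^kb\rangle\langle a+i^kb|$, term by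
term. The square-summable form of the expansion makes each of the four sums converge absolutely. -/
lemma exists_self_nuclearSum_decomposition (S : traceClass H) :
    ∃ (c : Fin 4 → ℕ → H) (R : Fin 4 → traceClass H) (l : Fin 4 → ℂ),
      (∀ k, NuclearSum (c k) (c k) (R k : H →L[ℂ] H)) ∧ S = ∑ k, l k • R k := by
  obtain ⟨a, b, h, ha, hb⟩ := exists_nuclearSum_sq S
  have hs : ∀ z : ℂ, NuclearSum (fun n => a n + z • b n) (fun n => a n + z • b n)
      (∑' n, rankOne ℂ (a n + z • b n) (a n + z • b n)) := fun z => by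
    refine NuclearSum.of_summable ?_
    refine Summable.of_nonneg_of_le (fun n => by positivity) (fun n => ?_)
      ((ha.mul_left 2).add (hb.mul_left (2 * ‖z‖ ^ 2)))
    have h1 := norm_add_le (a n) (z • b n)
    rw [norm_smul] at h1
    have h2 : 0 ≤ ‖a n + z • b n‖ := norm_nonneg _
    nlinarith [sq_nonneg (‖a n‖ - ‖z‖ * ‖b n‖)]
  refine ⟨fun k n => a n + (Complex.I ^ (k : ℕ)) • b n,
    fun k => ⟨_, (hs (Complex.I ^ (k : ℕ))).mem_traceClass⟩,
    fun k => Complex.I ^ (k : ℕ) / 4, fun k => hs _, Subtype.ext ?_⟩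
  simp only [Submodule.coe_sum, Submodule.coe_smul]
  refine h.2.unique ?_
  refine (hasSum_sum fun (k : Fin 4) _ =>
    (hs (Complex.I ^ (k : ℕ))).2.const_smul (Complex.I ^ (k : ℕ) / 4)).congr_fun fun n => ?_
  ext x
  simp [Fin.sum_univ_four, smul_add, smul_smul, pow_succ]
  match_scalars <;> (ring_nf; simp [Complex.I_sq]; try ring)

lemma IsOperation.ext_ketbra {Φ Ψ : traceClass H →ₗ[ℂ] traceClass H}
    (hΦ : IsOperation Φ) (hΨ : IsOperation Ψ)
    (h : ∀ x y, Φ (ketbra x y) = Ψ (ketbra x y)) : Φ = Ψ := by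
  ext1 S
  obtain ⟨c, R, l, hR, rfl⟩ := exists_self_nuclearSum_decomposition S
  simp only [map_sum, map_smul]
  exact Finset.sum_congr rfl fun k _ => by rw [hΦ.eq_of_nuclearSum_self hΨ h (hR k)]

end Abstract

/-! ### Kraus sums, their duals, and the instruments they define. -/

section Kraus

variable {H : Type*} [NormedAddCommGroup H] [InnerProductSpace ℂ H] [CompleteSpace H]
variable {ι κ : Type*} {a b : ι → H} {T : H →L[ℂ] H}

/-- The bounded operator representing a bounded sesquilinear form. -/
def formOp (F : H →L⋆[ℂ] H →L[ℂ] ℂ) : H →L[ℂ] H :=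
  star (continuousLinearMapOfBilin F)

lemma inner_formOp (F : H →L⋆[ℂ] H →L[ℂ] ℂ) (x y : H) : ⟪x, formOp F y⟫_ℂ = F x y := by
  rw [formOp, ContinuousLinearMap.star_eq_adjoint, ContinuousLinearMap.adjoint_inner_right,
    continuousLinearMapOfBilin_apply]

/-- Families of operators with `∑ᵢ Kᵢ* Kᵢ ≤ 1`. -/
def IsKraus (K : κ → H →L[ℂ] H) : Prop :=
  ∀ x, Summable (fun i => ‖K i x‖ ^ 2) ∧ ∑' i, ‖K i x‖ ^ 2 ≤ ‖x‖ ^ 2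

variable {K : κ → H →L[ℂ] H}

omit [CompleteSpace H] in
lemma IsKraus.summable_mul (hK : IsKraus K) (x y : H) : Summable (fun i => ‖K i x‖ * ‖K i y‖) :=
  (summable_mul_of_summable_sq (fun _ => norm_nonneg _) (fun _ => norm_nonneg _)
    (hK x).1 (hK y).1).1

omit [CompleteSpace H] in
lemma IsKraus.tsum_mul_le_sqrt (hK : IsKraus K) (x y : H) :
    ∑' i, ‖K i x‖ * ‖K i y‖ ≤ √(∑' i, ‖K i x‖ ^ 2) * √(∑' i, ‖K i y‖ ^ 2) :=
  (summable_mul_of_summable_sq (fun _ => norm_nonneg _) (fun _ => norm_nonneg _)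
    (hK x).1 (hK y).1).2

omit [CompleteSpace H] in
lemma IsKraus.tsum_mul_le (hK : IsKraus K) (x y : H) :
    ∑' i, ‖K i x‖ * ‖K i y‖ ≤ ‖x‖ * ‖y‖ := by
  refine (hK.tsum_mul_le_sqrt x y).trans ?_
  gcongr
  · exact Real.sqrt_le_iff.2 ⟨norm_nonneg _, (hK x).2⟩
  · exact Real.sqrt_le_iff.2 ⟨norm_nonneg _, (hK y).2⟩

omit [CompleteSpace H] in
lemma IsKraus.summable_prod (hK : IsKraus K) (h : Summable fun i => ‖a i‖ * ‖b i‖) :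
    Summable (fun q : ι × κ => ‖K q.2 (a q.1)‖ * ‖K q.2 (b q.1)‖) := by
  refine (summable_prod_of_nonneg fun q => by positivity).2
    ⟨fun i => hK.summable_mul (a i) (b i), ?_⟩
  exact h.of_nonneg_of_le (fun i => tsum_nonneg fun j => by positivity)
    (fun i => hK.tsum_mul_le (a i) (b i))

lemma mul_rankOne_mul_star (A : H →L[ℂ] H) (x y : H) :
    A * rankOne ℂ x y * star A = rankOne ℂ (A x) (A y) := by
  ext z
  simp [ContinuousLinearMap.star_eq_adjoint, ContinuousLinearMap.adjoint_inner_right]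

/-- The double family $|K_ia_n\rangle\langle K_ib_n|$ is absolutely summable by Cauchy–Schwarz in
$i$. Summing over $n$ first identifies its total with $\sum_iK_iTK_i^*$. -/
lemma IsKraus.nuclearSum (hK : IsKraus K) (h : NuclearSum a b T) :
    NuclearSum (fun q : ι × κ => K q.2 (a q.1)) (fun q => K q.2 (b q.1))
      (∑' i, K i * T * star (K i)) ∧ Summable (fun i => K i * T * star (K i)) := by
  have h1 := NuclearSum.of_summable (hK.summable_prod h.1)
  have h2 := ((Equiv.prodComm κ ι).hasSum_iff.2 h1.2).prod_fiberwise
    (g := fun i => K i * T * star (K i)) fun i => by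
      simpa [mul_rankOne_mul_star] using (h.2.mul_left (K i)).mul_right (star (K i))
  exact ⟨⟨h1.1, by rw [h2.tsum_eq]; exact h1.2⟩, h2.summable⟩

lemma IsKraus.summable (hK : IsKraus K) (S : traceClass H) :
    Summable (fun i => K i * (S : H →L[ℂ] H) * star (K i)) := by
  obtain ⟨a, b, h⟩ := exists_nuclearSum S
  exact (hK.nuclearSum h).2

/-- The map `T ↦ ∑ᵢ Kᵢ T Kᵢ*` on the trace class. -/
def krausMap [Countable κ] (hK : IsKraus K) : traceClass H →ₗ[ℂ] traceClass H where
  toFun S := ⟨∑' i, K i * (S : H →L[ℂ] H) * star (K i), by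
    obtain ⟨a, b, h⟩ := exists_nuclearSum S
    exact (hK.nuclearSum h).1.mem_traceClass⟩
  map_add' S T := Subtype.ext <| by
    simp only [Submodule.coe_add, mul_add, add_mul]
    exact (hK.summable S).tsum_add (hK.summable T)
  map_smul' c S := Subtype.ext <| by
    simp only [Submodule.coe_smul, mul_smul_comm, smul_mul_assoc, RingHom.id_apply]
    exact (hK.summable S).tsum_const_smul c

lemma IsKraus.nuclearSum_krausMap [Countable κ] (hK : IsKraus K) {S : traceClass H}
    (h : NuclearSum a b (S : H →L[ℂ] H)) :
    NuclearSum (fun q : ι × κ => K q.2 (a q.1)) (fun q => K q.2 (b q.1))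
      (krausMap hK S : H →L[ℂ] H) :=
  (hK.nuclearSum h).1

lemma krausMap_nonneg [Countable κ] (hK : IsKraus K) {S : traceClass H}
    (hS : 0 ≤ (S : H →L[ℂ] H)) : 0 ≤ (krausMap hK S : H →L[ℂ] H) := by
  refine nonneg_of_forall_inner_nonneg fun x => ?_
  have h := (innerSL ℂ x).hasSum ((ContinuousLinearMap.apply ℂ H x).hasSum (hK.summable S).hasSum)
  refine h.nonneg fun i => ?_
  have : ⟪x, K i ((S : H →L[ℂ] H) (star (K i) x))⟫_ℂ =
      ⟪star (K i) x, (S : H →L[ℂ] H) (star (K i) x)⟫_ℂ := by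
    rw [ContinuousLinearMap.star_eq_adjoint, ContinuousLinearMap.adjoint_inner_left]
  exact (inner_nonneg_of_nonneg hS _).trans_eq this.symm

omit [CompleteSpace H] in
lemma IsKraus.summable_inner (hK : IsKraus K) (B : H →L[ℂ] H) (x y : H) :
    Summable (fun i => ⟪K i x, B (K i y)⟫_ℂ) ∧
      ‖∑' i, ⟪K i x, B (K i y)⟫_ℂ‖ ≤ ‖B‖ * ‖x‖ * ‖y‖ := by
  have h1 : ∀ i, ‖⟪K i x, B (K i y)⟫_ℂ‖ ≤ ‖B‖ * (‖K i x‖ * ‖K i y‖) := fun i =>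
    calc _ ≤ ‖K i x‖ * ‖B (K i y)‖ := norm_inner_le_norm _ _
      _ ≤ ‖K i x‖ * (‖B‖ * ‖K i y‖) := by gcongr; exact B.le_opNorm _
      _ = _ := by ring
  have h2 := (hK.summable_mul x y).mul_left ‖B‖
  refine ⟨h2.of_norm_bounded h1, (tsum_of_norm_bounded h2.hasSum h1).trans ?_⟩
  rw [tsum_mul_left, mul_assoc]
  exact mul_le_mul_of_nonneg_left (hK.tsum_mul_le x y) (norm_nonneg _)

/-- The dual `B ↦ ∑ᵢ Kᵢ* B Kᵢ` of `krausMap`. -/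
def krausDual (hK : IsKraus K) (B : H →L[ℂ] H) : H →L[ℂ] H :=
  formOp <| LinearMap.mkContinuous₂ (LinearMap.mk₂'ₛₗ (starRingEnd ℂ) (RingHom.id ℂ)
    (fun x y => ∑' i, ⟪K i x, B (K i y)⟫_ℂ)
    (fun x x' y => by
      simp only [map_add, inner_add_left]
      exact (hK.summable_inner B x y).1.tsum_add (hK.summable_inner B x' y).1)
    (fun c x y => by
      simp only [map_smul, inner_smul_left, smul_eq_mul]
      exact tsum_mul_left)
    (fun x y y' => by
      simp only [map_add, inner_add_right]
      exact (hK.summable_inner B x y).1.tsum_add (hK.summable_inner B x y').1)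
    (fun c x y => by
      simp only [map_smul, inner_smul_right, smul_eq_mul, RingHom.id_apply]
      exact tsum_mul_left)) ‖B‖ fun x y => (hK.summable_inner B x y).2

lemma inner_krausDual (hK : IsKraus K) (B : H →L[ℂ] H) (x y : H) :
    ⟪x, krausDual hK B y⟫_ℂ = ∑' i, ⟪K i x, B (K i y)⟫_ℂ := by
  rw [krausDual, inner_formOp]
  rfl

lemma isDualImage_krausDual [Countable κ] (hK : IsKraus K) (B : H →L[ℂ] H) :
    IsDualImage (krausMap hK) B (krausDual hK B) := by
  intro S
  obtain ⟨a, b, h⟩ := exists_nuclearSum S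
  refine (h.hasSum_trace_mul _).unique ?_
  refine ((hK.nuclearSum_krausMap h).hasSum_trace_mul B).prod_fiberwise fun n => ?_
  rw [inner_krausDual]
  exact (hK.summable_inner B _ _).1.hasSum

lemma IsDualImage.unique {Φ : traceClass H →ₗ[ℂ] traceClass H} {A B C : H →L[ℂ] H}
    (h : IsDualImage Φ A B) (h' : IsDualImage Φ A C) : B = C := by
  refine eq_of_forall_inner_self fun x => ?_
  rw [← trace_ketbra_mul, ← trace_ketbra_mul, h, h']

/-- Weak continuity along a nuclear expansion, which lets identities between Kraus maps be checked
on rank one operators. -/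
lemma hasSum_krausMap_apply [Countable κ] (hK : IsKraus K) {S : traceClass H}
    (h : NuclearSum a b (S : H →L[ℂ] H)) (x y : H) :
    HasSum (fun i => ⟪x, (krausMap hK (ketbra (a i) (b i)) : H →L[ℂ] H) y⟫_ℂ)
      ⟪x, (krausMap hK S : H →L[ℂ] H) y⟫_ℂ := by
  refine ((hK.nuclearSum_krausMap h).hasSum_inner x y).prod_fiberwise fun n => ?_
  have := (hK.nuclearSum_krausMap (nuclearSum_ketbra (a n) (b n))).hasSum_inner x y
  exact (Equiv.punitProd κ).hasSum_iff.1 this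

/-- The square roots are kept, instead of being bounded by $\|a_n\|\|b_n\|$, so that they tend to
zero along tails of a disjoint union. -/
lemma traceNorm_krausMap_le [Countable κ] [Countable ι] (hK : IsKraus K) {S : traceClass H}
    (h : NuclearSum a b (S : H →L[ℂ] H)) :
    traceNorm (krausMap hK S) ≤
      ∑' n, √(∑' i, ‖K i (a n)‖ ^ 2) * √(∑' i, ‖K i (b n)‖ ^ 2) := by
  have h1 := (hK.nuclearSum_krausMap h)
  refine h1.traceNorm_le.trans ?_
  rw [h1.1.tsum_prod' fun n => hK.summable_mul (a n) (b n)]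
  refine Summable.tsum_le_tsum (fun n => hK.tsum_mul_le_sqrt (a n) (b n)) ?_ ?_
  · exact h.1.of_nonneg_of_le (fun n => tsum_nonneg fun i => by positivity)
      fun n => hK.tsum_mul_le (a n) (b n)
  · refine h.1.of_nonneg_of_le (fun n => by positivity) fun n => ?_
    exact mul_le_mul (Real.sqrt_le_iff.2 ⟨norm_nonneg _, (hK (a n)).2⟩)
      (Real.sqrt_le_iff.2 ⟨norm_nonneg _, (hK (b n)).2⟩) (Real.sqrt_nonneg _) (norm_nonneg _)

/-- A family of Kraus operators indexed by the Borel sets whose sums `∑ᵢ ‖Kᵢ(X) x‖²` are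
measures with total mass `‖x‖²`, and whose operations are finitely additive. -/
structure IsKrausInstrument (K : Set ℝ → κ → H →L[ℂ] H) (μ : H → Measure ℝ) : Prop where
  univ : ∀ x, μ x Set.univ = ENNReal.ofReal (‖x‖ ^ 2)
  hasSum : ∀ X, MeasurableSet X → ∀ x, HasSum (fun i => ‖K X i x‖ ^ 2) ((μ x).real X)
  add : ∀ X Y, MeasurableSet X → MeasurableSet Y → Disjoint X Y → ∀ x y f g,
    ∑' i, ⟪f, K (X ∪ Y) i x⟫_ℂ * ⟪K (X ∪ Y) i y, g⟫_ℂ =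
      ∑' i, ⟪f, K X i x⟫_ℂ * ⟪K X i y, g⟫_ℂ + ∑' i, ⟪f, K Y i x⟫_ℂ * ⟪K Y i y, g⟫_ℂ

namespace IsKrausInstrument

variable {K : Set ℝ → κ → H →L[ℂ] H} {μ : H → Measure ℝ} (h : IsKrausInstrument K μ)
include h

omit [CompleteSpace H] in
lemma isFiniteMeasure (x : H) : IsFiniteMeasure (μ x) := ⟨by simp [h.univ x]⟩

omit [CompleteSpace H] in
lemma real_univ (x : H) : (μ x).real Set.univ = ‖x‖ ^ 2 := by
  rw [Measure.real, h.univ, ENNReal.toReal_ofReal (by positivity)]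

omit [CompleteSpace H] in
lemma real_le (x : H) (X : Set ℝ) : (μ x).real X ≤ ‖x‖ ^ 2 := by
  have := h.isFiniteMeasure x
  rw [← h.real_univ]
  exact measureReal_mono (Set.subset_univ X)

omit [CompleteSpace H] in
lemma isKraus {X : Set ℝ} (hX : MeasurableSet X) : IsKraus (K X) := fun x =>
  ⟨(h.hasSum X hX x).summable, (h.hasSum X hX x).tsum_eq.trans_le (h.real_le x X)⟩

variable [Countable κ]

lemma krausMap_union {X Y : Set ℝ} (hX : MeasurableSet X) (hY : MeasurableSet Y)
    (hd : Disjoint X Y) : krausMap (h.isKraus (hX.union hY)) =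
      krausMap (h.isKraus hX) + krausMap (h.isKraus hY) := by
  have key : ∀ {Z} (hZ : MeasurableSet Z) x y f g,
      ⟪f, (krausMap (h.isKraus hZ) (ketbra x y) : H →L[ℂ] H) g⟫_ℂ =
        ∑' i, ⟪f, K Z i x⟫_ℂ * ⟪K Z i y, g⟫_ℂ := by
    intro Z hZ x y f g
    have := ((h.isKraus hZ).nuclearSum_krausMap (nuclearSum_ketbra x y)).hasSum_inner f g
    exact ((Equiv.punitProd κ).hasSum_iff
      (f := fun i => ⟪f, K Z i x⟫_ℂ * ⟪K Z i y, g⟫_ℂ)).1 this |>.tsum_eq.symm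
  ext1 S
  obtain ⟨a, b, hS⟩ := exists_nuclearSum S
  refine Subtype.ext (eq_of_forall_inner_self fun x => ?_)
  refine (hasSum_krausMap_apply _ hS x x).unique ?_
  simp only [LinearMap.add_apply, Submodule.coe_add, add_apply, inner_add_right]
  refine ((hasSum_krausMap_apply (h.isKraus hX) hS x x).add
    (hasSum_krausMap_apply (h.isKraus hY) hS x x)).congr_fun fun n => ?_
  rw [key hX, key hY, key (hX.union hY), h.add X Y hX hY hd]

lemma trace_krausMap_univ (S : traceClass H) :
    trace (krausMap (h.isKraus MeasurableSet.univ) S : H →L[ℂ] H) = trace (S : H →L[ℂ] H) := by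
  have hd : krausDual (h.isKraus MeasurableSet.univ) 1 = 1 := by
    refine eq_of_forall_inner_self fun x => ?_
    rw [inner_krausDual]
    have := (Complex.hasSum_ofReal).2 (h.hasSum _ MeasurableSet.univ x)
    simp only [one_apply_eq_self, inner_self_eq_norm_sq_to_K]
    rw [h.real_univ] at this
    exact_mod_cast this.tsum_eq
  have := isDualImage_krausDual (h.isKraus MeasurableSet.univ) 1 S
  rw [hd, mul_one, mul_one] at this
  exact this.symm

/-- The traces belonging to $X$ and to its complement are nonnegative and add up to the trace of the
state, which is one. -/
lemma isOperation {X : Set ℝ} (hX : MeasurableSet X) : IsOperation (krausMap (h.isKraus hX)) := by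
  refine ⟨fun S hS => krausMap_nonneg _ hS, fun S hS => ?_⟩
  have hp := fun {Z : Set ℝ} (hZ : MeasurableSet Z) => (Complex.nonneg_iff.1 (trace_nonneg
    (krausMap_nonneg (h.isKraus hZ) hS.1) (krausMap (h.isKraus hZ) S).2)).1
  refine ⟨hp hX, ?_⟩
  have h1 := h.krausMap_union hX hX.compl disjoint_compl_right
  have h2 : krausMap (h.isKraus (hX.union hX.compl)) = krausMap (h.isKraus MeasurableSet.univ) := by
    congr! 2; exact Set.union_compl_self X
  have h3 := h.trace_krausMap_univ S
  rw [← h2, h1, LinearMap.add_apply, Submodule.coe_add, trace_add (Subtype.prop _)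
    (Subtype.prop _), hS.2.2] at h3
  have h4 := congrArg Complex.re h3
  rw [Complex.add_re, Complex.one_re] at h4
  linarith [hp hX.compl]

/-- The induction step splits the set $X_n$ off the tail by finite additivity; what remains to
estimate for $\sigma$-additivity is the map of a tail. -/
lemma krausMap_iUnion {X : ℕ → Set ℝ} (hX : ∀ i, MeasurableSet (X i))
    (hd : Pairwise fun i j => Disjoint (X i) (X j)) (n : ℕ) :
    krausMap (h.isKraus (MeasurableSet.iUnion hX)) =
      ∑ i ∈ Finset.range n, krausMap (h.isKraus (hX i)) +
        krausMap (h.isKraus (MeasurableSet.iUnion fun i => hX (i + n))) := by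
  induction n with
  | zero => simp
  | succ n ih =>
    rw [ih, Finset.sum_range_succ, add_assoc]
    congr 1
    have hm := MeasurableSet.iUnion fun i => hX (i + (n + 1))
    rw [← h.krausMap_union (hX n) hm
      (Set.disjoint_iUnion_right.2 fun i => hd (by omega))]
    congr! 2
    ext x
    simp only [Set.mem_union, Set.mem_iUnion]
    constructor
    · rintro ⟨i, hi⟩
      rcases i with - | i
      · left; simpa using hi
      · right; exact ⟨i, by rwa [show i + (n + 1) = i + 1 + n by ring]⟩
    · rintro (hx | ⟨i, hi⟩)
      · exact ⟨0, by simpa using hx⟩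
      · exact ⟨i + 1, by rwa [show i + 1 + n = i + (n + 1) by ring]⟩

open Classical in
/-- The instrument `X ↦ (T ↦ ∑ᵢ Kᵢ(X) T Kᵢ(X)*)`. -/
def instrument : Instrument H where
  toFun X := if hX : MeasurableSet X then krausMap (h.isKraus hX) else 0
  not_measurable' X hX := by simp [hX]
  isOperation' X hX := by simpa [hX] using h.isOperation hX
  univ' S hS := by
    simp only [MeasurableSet.univ, dite_true]
    rw [h.trace_krausMap_univ, hS.2.2]
  tendsto' X hX hd S := by
    obtain ⟨a, b, hS⟩ := exists_nuclearSum S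
    simp only [hX, MeasurableSet.iUnion hX, dite_true]
    have e : ∀ n, krausMap (h.isKraus (MeasurableSet.iUnion hX)) S -
        ∑ i ∈ Finset.range n, krausMap (h.isKraus (hX i)) S =
        krausMap (h.isKraus (MeasurableSet.iUnion fun i => hX (i + n))) S := fun n => by
      rw [h.krausMap_iUnion hX hd n]
      simp
    simp only [e]
    have hz : ∀ x, Tendsto (fun n => √((μ x).real (⋃ i, X (i + n)))) atTop (𝓝 0) := by
      intro x
      have := h.isFiniteMeasure x
      rw [← Real.sqrt_zero]
      refine (Real.continuous_sqrt.tendsto 0).comp ?_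
      have h1 : ∀ n, (μ x).real (⋃ i, X (i + n)) = ∑' i, (μ x).real (X (i + n)) := fun n => by
        simp only [Measure.real]
        rw [measure_iUnion (fun i j hij => hd (by simpa using hij)) fun i => hX _,
          ENNReal.tsum_toReal_eq fun i => measure_ne_top _ _]
      simp only [h1]
      exact tendsto_sum_nat_add fun n => (μ x).real (X n)
    refine squeeze_zero (fun n => traceNorm_nonneg _)
      (fun n => traceNorm_krausMap_le _ hS) ?_
    simp only [(h.hasSum _ (MeasurableSet.iUnion fun i => hX (i + _)) _).tsum_eq]
    rw [← tsum_zero (α := ℝ) (β := ℕ)]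
    -- The masses of the tails tend to zero for each vector of the expansion, and $\|a_m\|\|b_m\|$
    -- dominates.
    refine tendsto_tsum_of_dominated_convergence hS.1 (fun m => ?_) (.of_forall fun n m => ?_)
    · simpa using (hz (a m)).mul (hz (b m))
    · rw [Real.norm_of_nonneg (by positivity)]
      gcongr
      · exact Real.sqrt_le_iff.2 ⟨norm_nonneg _, h.real_le _ _⟩
      · exact Real.sqrt_le_iff.2 ⟨norm_nonneg _, h.real_le _ _⟩

lemma instrument_apply {X : Set ℝ} (hX : MeasurableSet X) :
    h.instrument X = krausMap (h.isKraus hX) := by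
  simp [instrument, hX]

end IsKrausInstrument

end Kraus

/-! ### The Kraus operators of $I^\phi$ and their Parseval identities. -/

section Instrument

/-- Distinct members are at distance $\sqrt2$, so the balls of radius $1/2$ are disjoint open sets
in a separable space. -/
lemma countable_of_orthonormal {H κ : Type*} [NormedAddCommGroup H] [InnerProductSpace ℂ H]
    [TopologicalSpace.SeparableSpace H] {e : κ → H} (he : Orthonormal ℂ e) : Countable κ := by
  have hd : Pairwise (Function.onFun Disjoint fun i => Metric.ball (e i) (1 / 2)) := by
    intro i j hij
    refine Metric.ball_disjoint_ball ?_
    have h := norm_sub_sq (𝕜 := ℂ) (e i) (e j)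
    rw [he.2 hij, he.1 i, he.1 j] at h
    rw [dist_eq_norm]
    have h0 := norm_nonneg (e i - e j)
    have h1 : ‖e i - e j‖ ^ 2 = 2 := by simpa [one_add_one_eq_two] using h
    nlinarith
  exact hd.countable_of_isOpen_disjoint (fun _ => Metric.isOpen_ball)
    fun i => ⟨e i, Metric.mem_ball_self (by norm_num)⟩

lemma exists_countable_hilbertBasis :
    ∃ (w : Set L2) (_ : HilbertBasis w ℂ L2), Countable w := by
  have : Fact ((2 : ℝ≥0∞) ≠ ∞) := ⟨by simp⟩
  obtain ⟨w, e, -⟩ := exists_hilbertBasis ℂ L2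
  exact ⟨w, e, countable_of_orthonormal e.orthonormal⟩

lemma tsum_enorm_inner_sq {H κ : Type*} [NormedAddCommGroup H] [InnerProductSpace ℂ H]
    (e : HilbertBasis κ ℂ H) (x : H) : ∑' k, ‖⟪e k, x⟫_ℂ‖ₑ ^ 2 = ‖x‖ₑ ^ 2 := by
  have h := e.hasSum_inner_mul_inner x x
  have h2 : HasSum (fun k => ‖⟪e k, x⟫_ℂ‖ ^ 2) (‖x‖ ^ 2) := by
    rw [← Complex.hasSum_ofReal, Complex.ofReal_pow, ← Complex.coe_algebraMap,
      ← inner_self_eq_norm_sq_to_K (𝕜 := ℂ)]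
    refine h.congr_fun fun k => ?_
    rw [← inner_conj_symm x, Complex.conj_mul']
    norm_cast
  simp only [← ofReal_norm, ← ENNReal.ofReal_pow (norm_nonneg _)]
  rw [← h2.tsum_eq, ENNReal.ofReal_tsum_of_nonneg (fun k => by positivity) h2.summable]

lemma integral_conj_mul_self {α : Type*} [MeasurableSpace α] {μ : Measure α} {h : α → ℂ}
    (hm : AEStronglyMeasurable h μ) :
    ∫ t, starRingEnd ℂ (h t) * h t ∂μ = ((∫⁻ t, ‖h t‖ₑ ^ 2 ∂μ).toReal : ℂ) := by
  have h1 : ∀ t, starRingEnd ℂ (h t) * h t = ((‖h t‖ ^ 2 : ℝ) : ℂ) := fun t => by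
    rw [Complex.conj_mul']; norm_cast
  simp only [h1]
  rw [integral_complex_ofReal, integral_eq_lintegral_of_nonneg_ae
    (.of_forall fun t => by positivity) (by exact hm.norm.pow 2)]
  simp only [ENNReal.ofReal_pow (norm_nonneg _), ofReal_norm]

lemma measurable_L2 (f : L2) : Measurable f := (Lp.stronglyMeasurable f).measurable

lemma enorm_sq_eq_lintegral (f : L2) : ‖f‖ₑ ^ 2 = ∫⁻ x, ‖f x‖ₑ ^ 2 := by
  rw [Lp.enorm_def, eLpNorm_eq_lintegral_rpow_enorm_toReal (by simp) (by simp)]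
  simp only [ENNReal.toReal_ofNat, ENNReal.rpow_ofNat]
  rw [← ENNReal.rpow_natCast, ← ENNReal.rpow_mul]
  simp

lemma memLp_two_reflect (f : L2) (x : ℝ) :
    MemLp (fun z => starRingEnd ℂ (f (x - z))) 2 volume :=
  ((Lp.memLp f).comp_measurePreserving (Measure.measurePreserving_sub_left volume x)).star

lemma enorm_star_eq (z : ℂ) : ‖starRingEnd ℂ z‖ₑ = ‖z‖ₑ := by
  rw [← ofReal_norm, ← ofReal_norm, RCLike.norm_conj]

/-- The function `z ↦ χ_X(z) conj(φ(x - z))`. -/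
def slice (φ : L2) {X : Set ℝ} (hX : MeasurableSet X) (x : ℝ) : L2 :=
  ((memLp_two_reflect φ x).indicator hX).toLp

/-- The function `x ↦ ∫_X conj(u(z)) conj(φ(x - z)) dz`. -/
def coef (φ : L2) (X : Set ℝ) (u : L2) (x : ℝ) : ℂ :=
  ∫ z in X, starRingEnd ℂ (u z) * starRingEnd ℂ (φ (x - z))

/-- The function `(x, y) ↦ ∫_X conj(φ(x - z)) φ(y - z) dz`. -/
def correlation (φ : L2) (X : Set ℝ) (x y : ℝ) : ℂ :=
  ∫ z in X, starRingEnd ℂ (φ (x - z)) * φ (y - z)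

variable (φ : L2) {X Y : Set ℝ}

lemma slice_coeFn (hX : MeasurableSet X) (x : ℝ) :
    slice φ hX x =ᵐ[volume] X.indicator fun z => starRingEnd ℂ (φ (x - z)) :=
  MemLp.coeFn_toLp _

/-- This is what makes Parseval available: in a basis, the values `coef φ X (e k) x` are the
coordinates of the slice at `x`. -/
lemma coef_eq_inner (hX : MeasurableSet X) (u : L2) (x : ℝ) :
    coef φ X u x = ⟪u, slice φ hX x⟫_ℂ := by
  rw [L2.inner_def, coef, ← integral_indicator hX]
  refine integral_congr_ae ?_
  filter_upwards [slice_coeFn φ hX x] with z hz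
  rw [hz]
  by_cases h : z ∈ X <;> simp [h, mul_comm]

lemma correlation_eq_inner (hX : MeasurableSet X) (x y : ℝ) :
    correlation φ X x y = ⟪slice φ hX y, slice φ hX x⟫_ℂ := by
  rw [L2.inner_def, correlation, ← integral_indicator hX]
  refine integral_congr_ae ?_
  filter_upwards [slice_coeFn φ hX x, slice_coeFn φ hX y] with z hz hz'
  rw [hz, hz']
  by_cases h : z ∈ X <;> simp [h]

lemma enorm_slice_sq (hX : MeasurableSet X) (x : ℝ) :
    ‖slice φ hX x‖ₑ ^ 2 = ∫⁻ z in X, ‖φ (x - z)‖ₑ ^ 2 := by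
  rw [enorm_sq_eq_lintegral, ← lintegral_indicator hX]
  refine lintegral_congr_ae ?_
  filter_upwards [slice_coeFn φ hX x] with z hz
  rw [hz]
  by_cases h : z ∈ X <;> simp [h]

lemma lintegral_reflect_sq (x : ℝ) : ∫⁻ z, ‖φ (x - z)‖ₑ ^ 2 = ‖φ‖ₑ ^ 2 := by
  rw [enorm_sq_eq_lintegral]
  exact lintegral_sub_left_eq_self (fun z => ‖φ z‖ₑ ^ 2) x

lemma norm_slice_le (hX : MeasurableSet X) (x : ℝ) : ‖slice φ hX x‖ ≤ ‖φ‖ := by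
  have h : ‖slice φ hX x‖ₑ ^ 2 ≤ ‖φ‖ₑ ^ 2 := by
    rw [enorm_slice_sq, ← lintegral_reflect_sq φ x]
    exact setLIntegral_le_lintegral _ _
  rw [← enorm_le_iff_norm_le]
  exact (ENNReal.pow_le_pow_left_iff two_ne_zero).1 h

lemma measurable_coef (X : Set ℝ) (u : L2) : Measurable (coef φ X u) := by
  have h : StronglyMeasurable (fun q : ℝ × ℝ => starRingEnd ℂ (u q.2) *
      starRingEnd ℂ (φ (q.1 - q.2))) := by
    refine Measurable.stronglyMeasurable ?_
    exact (RCLike.continuous_conj.measurable.comp ((measurable_L2 u).comp measurable_snd)).mul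
      (RCLike.continuous_conj.measurable.comp
        ((measurable_L2 φ).comp (measurable_fst.sub measurable_snd)))
  exact (h.integral_prod_right (ν := volume.restrict X)).measurable

lemma measurable_correlation (X : Set ℝ) :
    Measurable (fun q : ℝ × ℝ => correlation φ X q.1 q.2) := by
  have h : StronglyMeasurable (fun q : (ℝ × ℝ) × ℝ => starRingEnd ℂ (φ (q.1.1 - q.2)) *
      φ (q.1.2 - q.2)) := by
    refine Measurable.stronglyMeasurable ?_
    exact (RCLike.continuous_conj.measurable.comp ((measurable_L2 φ).comp
      ((measurable_fst.comp measurable_fst).sub measurable_snd))).mul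
      ((measurable_L2 φ).comp ((measurable_snd.comp measurable_fst).sub measurable_snd))
  exact (h.integral_prod_right (ν := volume.restrict X)).measurable

lemma norm_coef_le (X : Set ℝ) (u : L2) (x : ℝ) : ‖coef φ X u x‖ ≤ ‖u‖ * ‖φ‖ := by
  -- `krausOp` is defined for arbitrary sets, hence the passage to a measurable hull, which does not
  -- change the restricted measure.
  have h : coef φ X u x = coef φ (toMeasurable volume X) u x := by
    rw [coef, coef, Measure.restrict_toMeasurable_of_sFinite]
  rw [h, coef_eq_inner φ (measurableSet_toMeasurable _ _)]
  exact (norm_inner_le_norm _ _).trans (by gcongr; exact norm_slice_le φ _ x)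

lemma memLp_coef (X : Set ℝ) (u : L2) : MemLp (coef φ X u) ∞ volume :=
  memLp_top_of_bound (measurable_coef φ X u).aestronglyMeasurable (‖u‖ * ‖φ‖)
    (.of_forall fun x => norm_coef_le φ X u x)

/-- Multiplication by `x ↦ ∫_X conj(u(z)) conj(φ(x - z)) dz`. -/
def krausOp (X : Set ℝ) (u : L2) : L2 →L[ℂ] L2 := mulOp (coef φ X u) (memLp_coef φ X u)

lemma krausOp_coeFn (X : Set ℝ) (u f : L2) :
    krausOp φ X u f =ᵐ[volume] fun x => coef φ X u x * f x := mulOp_coeFn _ _ f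

variable {κ : Type*} (e : HilbertBasis κ ℂ L2)

/-- Parseval for the slices at $x$ and $y$: the sum over the basis produces exactly the correlation
factor of the kernel. -/
lemma hasSum_coef_mul (hX : MeasurableSet X) (x y : ℝ) :
    HasSum (fun k => coef φ X (e k) x * starRingEnd ℂ (coef φ X (e k) y))
      (correlation φ X x y) := by
  simpa only [correlation_eq_inner φ hX, coef_eq_inner φ hX, inner_conj_symm, mul_comm] using
    e.hasSum_inner_mul_inner (slice φ hX y) (slice φ hX x)

lemma summable_norm_coef_mul (hX : MeasurableSet X) (x y : ℝ) :
    Summable (fun k => ‖coef φ X (e k) x‖ * ‖coef φ X (e k) y‖) ∧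
      ∑' k, ‖coef φ X (e k) x‖ * ‖coef φ X (e k) y‖ ≤ ‖φ‖ ^ 2 := by
  have h := summable_norm_inner_mul_inner e (slice φ hX x) (slice φ hX y)
  simp only [norm_inner_symm (slice φ hX y), ← coef_eq_inner φ hX] at h
  refine ⟨h.1, h.2.trans ?_⟩
  rw [pow_two]
  gcongr <;> exact norm_slice_le φ hX _

lemma norm_correlation_le (hX : MeasurableSet X) (x y : ℝ) : ‖correlation φ X x y‖ ≤ ‖φ‖ ^ 2 := by
  rw [correlation_eq_inner φ hX, pow_two]
  refine (norm_inner_le_norm _ _).trans ?_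
  gcongr <;> exact norm_slice_le φ hX _

lemma tsum_enorm_coef_sq (hX : MeasurableSet X) (x : ℝ) :
    ∑' k, ‖coef φ X (e k) x‖ₑ ^ 2 = ∫⁻ z in X, ‖φ (x - z)‖ₑ ^ 2 := by
  rw [← enorm_slice_sq φ hX, ← tsum_enorm_inner_sq e]
  simp only [coef_eq_inner φ hX]

lemma inner_krausOp (u f g : L2) :
    ⟪f, krausOp φ X u g⟫_ℂ = ∫ x, coef φ X u x * ⟪f x, g x⟫_ℂ := inner_mulOp _ _ f g

lemma inner_krausOp_left (u f g : L2) :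
    ⟪krausOp φ X u f, g⟫_ℂ = ∫ x, starRingEnd ℂ (coef φ X u x) * ⟪f x, g x⟫_ℂ := by
  rw [← inner_conj_symm, inner_krausOp, ← integral_conj]
  simp [mul_comm]

lemma integrable_inner_mul_correlation (hX : MeasurableSet X) (f g a b : L2) :
    Integrable (fun q : ℝ × ℝ => ⟪f q.1, a q.1⟫_ℂ * ⟪b q.2, g q.2⟫_ℂ *
      correlation φ X q.1 q.2) (volume.prod volume) :=
  (Integrable.mul_prod (L2.integrable_inner (𝕜 := ℂ) f a)
    (L2.integrable_inner (𝕜 := ℂ) b g)).mul_bdd (c := ‖φ‖ ^ 2)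
    (measurable_correlation φ X).aestronglyMeasurable
    (.of_forall fun _ => norm_correlation_le φ hX _ _)

/-- Each term is a double integral over $(x,y)$; dominated convergence carries the pointwise
Parseval identity under the integral, with dominating sum at most $\|\phi\|^2$ times an integrable
function. -/
lemma hasSum_inner_krausOp [Countable κ] (hX : MeasurableSet X) (f g a b : L2) :
    HasSum (fun k => ⟪f, krausOp φ X (e k) a⟫_ℂ * ⟪krausOp φ X (e k) b, g⟫_ℂ)
      (∫ q : ℝ × ℝ, ⟪f q.1, a q.1⟫_ℂ * ⟪b q.2, g q.2⟫_ℂ * correlation φ X q.1 q.2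
        ∂(volume.prod volume)) := by
  have hF : Integrable (fun q : ℝ × ℝ => ⟪f q.1, a q.1⟫_ℂ * ⟪b q.2, g q.2⟫_ℂ)
      (volume.prod volume) := Integrable.mul_prod (L2.integrable_inner (𝕜 := ℂ) f a)
        (L2.integrable_inner (𝕜 := ℂ) b g)
  have hc : ∀ k, Measurable fun q : ℝ × ℝ =>
      coef φ X (e k) q.1 * starRingEnd ℂ (coef φ X (e k) q.2) := fun k =>
    ((measurable_coef φ X (e k)).comp measurable_fst).mul
      (RCLike.continuous_conj.measurable.comp ((measurable_coef φ X (e k)).comp measurable_snd))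
  have key : ∀ k, ⟪f, krausOp φ X (e k) a⟫_ℂ * ⟪krausOp φ X (e k) b, g⟫_ℂ =
      ∫ q : ℝ × ℝ, ⟪f q.1, a q.1⟫_ℂ * ⟪b q.2, g q.2⟫_ℂ *
        (coef φ X (e k) q.1 * starRingEnd ℂ (coef φ X (e k) q.2)) ∂(volume.prod volume) := by
    intro k
    rw [inner_krausOp, inner_krausOp_left, ← integral_prod_mul]
    congr 1; ext q; ring
  simp only [key]
  have hn : ∀ k (q : ℝ × ℝ), ‖⟪f q.1, a q.1⟫_ℂ * ⟪b q.2, g q.2⟫_ℂ *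
        (coef φ X (e k) q.1 * starRingEnd ℂ (coef φ X (e k) q.2))‖ =
      ‖⟪f q.1, a q.1⟫_ℂ * ⟪b q.2, g q.2⟫_ℂ‖ *
        (‖coef φ X (e k) q.1‖ * ‖coef φ X (e k) q.2‖) := fun k q => by
    rw [norm_mul, norm_mul (coef φ X (e k) q.1), RCLike.norm_conj]
  refine hasSum_integral_of_dominated_convergence (fun k (q : ℝ × ℝ) =>
      ‖⟪f q.1, a q.1⟫_ℂ * ⟪b q.2, g q.2⟫_ℂ‖ *
        (‖coef φ X (e k) q.1‖ * ‖coef φ X (e k) q.2‖)) ?_ ?_ ?_ ?_ ?_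
  · exact fun k => hF.aestronglyMeasurable.mul (hc k).aestronglyMeasurable
  · exact fun k => .of_forall fun q => (hn k q).le
  · exact .of_forall fun q => (summable_norm_coef_mul φ e hX q.1 q.2).1.mul_left _
  · simp only [tsum_mul_left]
    refine hF.norm.mul_bdd (c := ‖φ‖ ^ 2) ?_ (.of_forall fun q => ?_)
    · refine Measurable.aestronglyMeasurable ?_
      exact Measurable.tsum (fun k => ((measurable_coef φ X (e k)).comp measurable_fst).norm.mul
        ((measurable_coef φ X (e k)).comp measurable_snd).norm)
    · rw [Real.norm_of_nonneg (tsum_nonneg fun k => by positivity)]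
      exact (summable_norm_coef_mul φ e hX q.1 q.2).2
  · exact .of_forall fun q => (hasSum_coef_mul φ e hX q.1 q.2).mul_left _

/-- The position distribution of the outcomes of `I^φ` in the state `|f⟩⟨f|`. -/
def outcomeMeasure (f : L2) : Measure ℝ :=
  volume.withDensity fun z => ∫⁻ x, ‖φ (x - z)‖ₑ ^ 2 * ‖f x‖ₑ ^ 2

lemma measurable_shear (f : L2) :
    Measurable (fun q : ℝ × ℝ => ‖φ (q.2 - q.1)‖ₑ ^ 2 * ‖f q.2‖ₑ ^ 2) :=
  (((measurable_L2 φ).comp (measurable_snd.sub measurable_fst)).enorm.pow_const 2).mul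
    (((measurable_L2 f).comp measurable_snd).enorm.pow_const 2)

lemma outcomeMeasure_apply (hX : MeasurableSet X) (f : L2) :
    outcomeMeasure φ f X = ∫⁻ x, (∫⁻ z in X, ‖φ (x - z)‖ₑ ^ 2) * ‖f x‖ₑ ^ 2 := by
  rw [outcomeMeasure, withDensity_apply _ hX,
    lintegral_lintegral_swap (measurable_shear φ f).aemeasurable]
  refine lintegral_congr fun x => ?_
  rw [lintegral_mul_const]
  exact ((measurable_L2 φ).comp (measurable_const.sub measurable_id)).enorm.pow_const 2

/-- Parseval at a fixed $x$ followed by Tonelli. It shows that the total squared norm is a measure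
in $X$. -/
lemma tsum_enorm_krausOp_sq [Countable κ] (hX : MeasurableSet X) (f : L2) :
    ∑' k, ‖krausOp φ X (e k) f‖ₑ ^ 2 = outcomeMeasure φ f X := by
  rw [outcomeMeasure_apply φ hX]
  have h : ∀ k, ‖krausOp φ X (e k) f‖ₑ ^ 2 = ∫⁻ x, ‖coef φ X (e k) x‖ₑ ^ 2 * ‖f x‖ₑ ^ 2 := by
    intro k
    rw [enorm_sq_eq_lintegral]
    refine lintegral_congr_ae ?_
    filter_upwards [krausOp_coeFn φ X (e k) f] with x hx
    rw [hx, enorm_mul, mul_pow]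
  simp only [h]
  have hm : ∀ k, AEMeasurable (fun x => ‖coef φ X (e k) x‖ₑ ^ 2 * ‖f x‖ₑ ^ 2) volume := fun k =>
    (((measurable_coef φ X (e k)).enorm.pow_const 2).mul
      ((measurable_L2 f).enorm.pow_const 2)).aemeasurable
  rw [← lintegral_tsum hm]
  refine lintegral_congr fun x => ?_
  rw [ENNReal.tsum_mul_right, tsum_enorm_coef_sq φ e hX]

variable {φ}

lemma isKrausInstrument (hφ : ‖φ‖ = 1) [Countable κ] :
    IsKrausInstrument (fun X k => krausOp φ X (e k)) (outcomeMeasure φ) := by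
  have hu : ∀ f, outcomeMeasure φ f Set.univ = ENNReal.ofReal (‖f‖ ^ 2) := fun f => by
    have h1 : ‖φ‖ₑ = 1 := by rw [← ofReal_norm, hφ, ENNReal.ofReal_one]
    rw [outcomeMeasure_apply φ MeasurableSet.univ]
    simp only [Measure.restrict_univ, lintegral_reflect_sq, h1, one_pow, one_mul]
    rw [← enorm_sq_eq_lintegral, ← ofReal_norm, ENNReal.ofReal_pow (norm_nonneg _)]
  refine ⟨hu, fun X hX f => ?_, fun X Y hX hY hd a b f g => ?_⟩
  · have h1 := tsum_enorm_krausOp_sq φ e hX f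
    have h2 : outcomeMeasure φ f X ≠ ∞ :=
      ne_top_of_le_ne_top (by simp [hu]) (measure_mono (Set.subset_univ X))
    rw [Measure.real, ← h1]
    have h3 := ENNReal.hasSum_toReal (h1 ▸ h2)
    rw [← ENNReal.tsum_toReal_eq fun k => by simp] at h3
    simpa using h3
  -- Each product need not be additive in the set, but its sum over the basis depends on the set
  -- only through `correlation`, an integral over it.
  · rw [(hasSum_inner_krausOp φ e (hX.union hY) f g a b).tsum_eq,
      (hasSum_inner_krausOp φ e hX f g a b).tsum_eq, (hasSum_inner_krausOp φ e hY f g a b).tsum_eq,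
      ← integral_add (integrable_inner_mul_correlation φ hX f g a b)
        (integrable_inner_mul_correlation φ hY f g a b)]
    refine integral_congr_ae (.of_forall fun q => ?_)
    have hi : Integrable (fun z => starRingEnd ℂ (φ (q.1 - z)) * φ (q.2 - z)) := by
      refine ((memLp_two_reflect φ q.1).integrable_mul (memLp_two_reflect φ q.2).star).congr ?_
      exact .of_forall fun z => by simp
    simp only [correlation]
    rw [setIntegral_union hd hY hi.integrableOn hi.integrableOn, mul_add]

/-- The instrument `I^φ`. -/
def phiInstrument (hφ : ‖φ‖ = 1) [Countable κ] : Instrument L2 :=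
  (isKrausInstrument e hφ).instrument

lemma phiInstrument_apply (hφ : ‖φ‖ = 1) [Countable κ] (hX : MeasurableSet X) :
    phiInstrument e hφ X = krausMap ((isKrausInstrument e hφ).isKraus hX) :=
  (isKrausInstrument e hφ).instrument_apply hX

/-- Tested against an arbitrary $f$, Fubini identifies the value at $\psi$ with $a$ multiplied by
the bounded function $x\mapsto\int\overline{b(y)}\psi(y)\,C_X(x,y)\,dy$, where $C_X$ is the
correlation. -/
lemma isPhiInstrument_phiInstrument (hφ : ‖φ‖ = 1) [Countable κ] :
    IsPhiInstrument φ (phiInstrument e hφ) := by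
  intro X hX a b ψ
  rw [phiInstrument_apply e hφ hX]
  set A := (krausMap ((isKrausInstrument e hφ).isKraus hX) (ketbra a b) : L2 →L[ℂ] L2) with hA
  set B : ℝ → ℂ := fun x => ∫ y, ⟪b y, ψ y⟫_ℂ * correlation φ X x y with hB
  have hBm : Measurable B := by
    have : StronglyMeasurable fun q : ℝ × ℝ => ⟪b q.2, ψ q.2⟫_ℂ * correlation φ X q.1 q.2 :=
      ((((measurable_L2 b).comp measurable_snd).inner
        ((measurable_L2 ψ).comp measurable_snd)).mul
          (measurable_correlation φ X)).stronglyMeasurable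
    exact this.integral_prod_right.measurable
  have hBb : ∀ x, ‖B x‖ ≤ ∫ y, ‖⟪b y, ψ y⟫_ℂ‖ * ‖φ‖ ^ 2 := fun x => by
    refine norm_integral_le_of_norm_le ((L2.integrable_inner (𝕜 := ℂ) b ψ).norm.mul_const _)
      (.of_forall fun y => ?_)
    rw [norm_mul]
    gcongr
    exact norm_correlation_le φ hX x y
  have hBL : MemLp B ∞ volume :=
    memLp_top_of_bound hBm.aestronglyMeasurable _ (.of_forall hBb)
  have key : A ψ = mulOp B hBL a := by
    refine ext_inner_left ℂ fun f => ?_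
    have h1 := ((isKrausInstrument e hφ).isKraus hX).nuclearSum_krausMap (nuclearSum_ketbra a b)
    have h2 := (Equiv.punitProd κ).hasSum_iff
      (f := fun k => ⟪f, krausOp φ X (e k) a⟫_ℂ * ⟪krausOp φ X (e k) b, ψ⟫_ℂ) |>.1
      (h1.hasSum_inner f ψ)
    rw [h2.unique (hasSum_inner_krausOp φ e hX f ψ a b), inner_mulOp,
      integral_prod _ (integrable_inner_mul_correlation φ hX f ψ a b)]
    refine integral_congr_ae (.of_forall fun x => ?_)
    simp only [hB, mul_assoc]
    rw [integral_const_mul, mul_comm]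
  rw [key]
  filter_upwards [mulOp_coeFn B hBL a] with x hx
  rw [hx, hB, mul_comm, ← integral_const_mul]
  refine integral_congr_ae (.of_forall fun y => ?_)
  simp only [kernel, correlation, RCLike.inner_apply]
  ring

lemma IsIntegralOperator.unique {A B : L2 →L[ℂ] L2} {k : ℝ → ℝ → ℂ}
    (hA : IsIntegralOperator A k) (hB : IsIntegralOperator B k) : A = B := by
  ext1 ψ
  exact Lp.ext ((hA ψ).trans (hB ψ).symm)

lemma IsPhiInstrument.unique {I J : Instrument L2} (hI : IsPhiInstrument φ I)
    (hJ : IsPhiInstrument φ J) : I = J := by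
  refine Instrument.ext (funext fun X => ?_)
  by_cases hX : MeasurableSet X
  · exact (I.isOperation' X hX).ext_ketbra (J.isOperation' X hX) fun a b =>
      Subtype.ext ((hI X hX a b).unique (hJ X hX a b))
  · rw [I.not_measurable' X hX, J.not_measurable' X hX]

end Instrument

/-! ### The Fourier–Plancherel transform of integrable functions is given by the integral. -/

section Fourier

open scoped FourierTransform ContDiff

/-- Both sides are locally integrable, so smooth compactly supported test functions suffice. The
$L^2$ transform moves onto the test function as for tempered distributions, and the multiplication
formula for integrable functions moves it back. -/
lemma fourierTransform_ae_eq (f : L2) (hf : Integrable f) :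
    (Lp.fourierTransformₗᵢ ℝ ℂ f : L2) =ᵐ[volume] 𝓕 (f : ℝ → ℂ) := by
  have hc : Continuous (𝓕 (f : ℝ → ℂ)) :=
    VectorFourier.fourierIntegral_continuous Real.continuous_fourierChar
      (by exact continuous_inner) hf
  refine ae_eq_of_integral_contDiff_smul_eq
    ((Lp.memLp _).locallyIntegrable (by norm_num)) hc.locallyIntegrable fun g hg hg' => ?_
  have hs : HasCompactSupport (fun x => (g x : ℂ)) := hg'.comp_left Complex.ofReal_zero
  have hd : ContDiff ℝ ∞ (fun x => (g x : ℂ)) := Complex.ofRealCLM.contDiff.comp hg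
  set G : SchwartzMap ℝ ℂ := hs.toSchwartzMap hd with hG
  have h1 := DFunLike.congr_fun (Lp.fourier_toTemperedDistribution_eq f) G
  rw [TemperedDistribution.fourier_apply, Lp.toTemperedDistribution_apply,
    Lp.toTemperedDistribution_apply] at h1
  have h2 : ∫ ξ, 𝓕 G ξ • f ξ = ∫ x, G x • 𝓕 (f : ℝ → ℂ) x := by
    simpa using! VectorFourier.integral_fourierIntegral_smul_eq_flip (L := innerₗ ℝ)
      Real.continuous_fourierChar (by exact continuous_inner) G.integrable hf
  have h3 := h1.symm.trans h2
  have h4 : ∀ x (w : ℂ), G x • w = g x • w := fun x w => by simp [hG]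
  simp only [h4] at h3
  exact h3

lemma fourierPlancherel_ae_eq (f : L2) (hf : Integrable f) :
    fourierPlancherel f =ᵐ[volume] fun y => ((√(2 * Real.pi))⁻¹ : ℂ) *
      ∫ x : ℝ, Complex.exp (-(Complex.I * y * x)) * f x := by
  have hc : (0 : ℝ) < (2 * Real.pi)⁻¹ := by positivity
  filter_upwards [dilationₗᵢ_coeFn _ hc (Lp.fourierTransformₗᵢ ℝ ℂ f),
    (quasiMeasurePreserving_mul _ hc).ae (fourierTransform_ae_eq f hf)] with y h1 h2
  have h3 : fourierPlancherel f = dilationₗᵢ _ hc (Lp.fourierTransformₗᵢ ℝ ℂ f) := rfl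
  rw [h3, h1, h2, Real.sqrt_inv, Complex.ofReal_inv, Real.fourier_real_eq_integral_exp_smul]
  congr 1
  refine integral_congr_ae (.of_forall fun x => ?_)
  simp only [smul_eq_mul]
  congr 2
  push_cast
  have : (Real.pi : ℂ) ≠ 0 := by exact_mod_cast Real.pi_ne_zero
  field_simp

end Fourier

/-! ### The windowed Fourier transform. -/

section ShortTime

variable (φ : L2) {X Y : Set ℝ}

/-- The windowed Fourier transform
`(2π)^{-1/2} ∫ e^{-ipx} conj(φ(x - q)) f(x) dx`. -/
def windowedFourier (f : L2) (q p : ℝ) : ℂ :=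
  ((√(2 * Real.pi))⁻¹ : ℂ) *
    ∫ x : ℝ, Complex.exp (-(Complex.I * p * x)) * (starRingEnd ℂ (φ (x - q)) * f x)

lemma norm_exp_neg_I_mul (p x : ℝ) : ‖Complex.exp (-(Complex.I * p * x))‖ = 1 := by
  have : -(Complex.I * p * x) = ((-(p * x) : ℝ) : ℂ) * Complex.I := by push_cast; ring
  rw [this, Complex.norm_exp_ofReal_mul_I]

lemma memLp_two_translate (q : ℝ) :
    MemLp (fun x => starRingEnd ℂ (φ (x - q))) 2 volume :=
  ((Lp.memLp φ).comp_measurePreserving (measurePreserving_sub_right volume q)).star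

lemma integrable_translate_mul (f : L2) (q : ℝ) :
    Integrable (fun x => starRingEnd ℂ (φ (x - q)) * f x) :=
  (memLp_two_translate φ q).integrable_mul (Lp.memLp f)

lemma measurable_translate_mul (f : L2) :
    Measurable (fun r : ℝ × ℝ => starRingEnd ℂ (φ (r.2 - r.1)) * f r.2) :=
  (RCLike.continuous_conj.measurable.comp
    ((measurable_L2 φ).comp (measurable_snd.sub measurable_fst))).mul
      ((measurable_L2 f).comp measurable_snd)

lemma measurable_windowedFourier (f : L2) :
    Measurable (fun z : ℝ × ℝ => windowedFourier φ f z.1 z.2) := by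
  have h : StronglyMeasurable (fun r : (ℝ × ℝ) × ℝ => Complex.exp (-(Complex.I * r.1.2 * r.2)) *
      (starRingEnd ℂ (φ (r.2 - r.1.1)) * f r.2)) := by
    refine Measurable.stronglyMeasurable (Measurable.mul (by fun_prop) ?_)
    exact (measurable_translate_mul φ f).comp
      ((measurable_fst.comp measurable_fst).prodMk measurable_snd)
  exact h.integral_prod_right.measurable.const_mul _

lemma measurable_reflect_sq (x : ℝ) : Measurable fun z => ‖φ (x - z)‖ₑ ^ 2 :=
  ((measurable_L2 φ).comp (measurable_const.sub measurable_id :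
    Measurable fun z => x - z)).enorm.pow_const 2

lemma lintegral_translate_mul_sq (f : L2) :
    ∫⁻ q, ∫⁻ x, ‖starRingEnd ℂ (φ (x - q)) * f x‖ₑ ^ 2 = ‖φ‖ₑ ^ 2 * ‖f‖ₑ ^ 2 := by
  rw [lintegral_lintegral_swap
    ((measurable_translate_mul φ f).enorm.pow_const 2).aemeasurable]
  have h : ∀ x, ∫⁻ q, ‖starRingEnd ℂ (φ (x - q)) * f x‖ₑ ^ 2 = ‖φ‖ₑ ^ 2 * ‖f x‖ₑ ^ 2 := by
    intro x
    simp only [enorm_mul, mul_pow, enorm_star_eq]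
    rw [lintegral_mul_const _ (measurable_reflect_sq φ x), lintegral_reflect_sq]
  simp only [h]
  rw [lintegral_const_mul _ ((measurable_L2 f).enorm.pow_const 2), enorm_sq_eq_lintegral f]

/-- A product of two $L^2$ functions need not be in $L^2$; the finite double integral gives it for
almost every $q$, which is enough for Plancherel below. -/
lemma ae_memLp_translate_mul (f : L2) :
    ∀ᵐ q, MemLp (fun x => starRingEnd ℂ (φ (x - q)) * f x) 2 volume := by
  have hfin : ∫⁻ q, ∫⁻ x, ‖starRingEnd ℂ (φ (x - q)) * f x‖ₑ ^ 2 ≠ ∞ := by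
    rw [lintegral_translate_mul_sq]
    exact ENNReal.mul_ne_top (by simp) (by simp)
  have hm := ((measurable_translate_mul φ f).enorm.pow_const 2).lintegral_prod_right' (ν := volume)
  filter_upwards [ae_lt_top hm hfin] with q hq
  refine ⟨(integrable_translate_mul φ f q).aestronglyMeasurable, ?_⟩
  rw [eLpNorm_lt_top_iff_lintegral_rpow_enorm_lt_top (by simp) (by simp)]
  simpa using hq

lemma lintegral_windowedFourier_sq (f : L2) {q : ℝ}
    (hq : MemLp (fun x => starRingEnd ℂ (φ (x - q)) * f x) 2 volume) :
    ∫⁻ p, ‖windowedFourier φ f q p‖ₑ ^ 2 = ∫⁻ x, ‖starRingEnd ℂ (φ (x - q)) * f x‖ₑ ^ 2 := by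
  have hc := hq.coeFn_toLp
  have h1 := fourierPlancherel_ae_eq hq.toLp ((integrable_translate_mul φ f q).congr hc.symm)
  have h2 : ‖fourierPlancherel hq.toLp‖ₑ ^ 2 = ‖hq.toLp‖ₑ ^ 2 := by
    rw [← ofReal_norm, fourierPlancherel.norm_map, ofReal_norm]
  rw [enorm_sq_eq_lintegral, enorm_sq_eq_lintegral] at h2
  refine (lintegral_congr_ae ?_).trans (h2.trans (lintegral_congr_ae ?_))
  · filter_upwards [h1] with p hp
    rw [hp, windowedFourier]
    congr 3
    refine integral_congr_ae ?_
    filter_upwards [hc] with x hx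
    rw [hx]
  · filter_upwards [hc] with x hx
    rw [hx]

/-- Plancherel in $p$ for almost every $q$, then Tonelli: the orthogonality relation behind the
normalization of $G$. -/
lemma lintegral_lintegral_windowedFourier_sq (f : L2) :
    ∫⁻ q, ∫⁻ p, ‖windowedFourier φ f q p‖ₑ ^ 2 = ‖φ‖ₑ ^ 2 * ‖f‖ₑ ^ 2 := by
  rw [← lintegral_translate_mul_sq]
  refine lintegral_congr_ae ?_
  filter_upwards [ae_memLp_translate_mul φ f] with q hq
  exact lintegral_windowedFourier_sq φ f hq

/-- Here $p$ is fixed and $q$ varies, since Parseval is later applied in the variable $q$. -/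
lemma ae_memLp_windowedFourier (f : L2) :
    ∀ᵐ p, MemLp (fun q => windowedFourier φ f q p) 2 volume := by
  have hm : Measurable fun z : ℝ × ℝ => ‖windowedFourier φ f z.2 z.1‖ₑ ^ 2 :=
    ((measurable_windowedFourier φ f).comp measurable_swap).enorm.pow_const 2
  have hfin : ∫⁻ p, ∫⁻ q, ‖windowedFourier φ f q p‖ₑ ^ 2 ≠ ∞ := by
    rw [lintegral_lintegral_swap hm.aemeasurable, lintegral_lintegral_windowedFourier_sq]
    exact ENNReal.mul_ne_top (by simp) (by simp)
  filter_upwards [ae_lt_top (hm.lintegral_prod_right' (ν := volume)) hfin] with p hp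
  refine ⟨((measurable_windowedFourier φ f).comp
    (measurable_id.prodMk measurable_const)).aestronglyMeasurable, ?_⟩
  rw [eLpNorm_lt_top_iff_lintegral_rpow_enorm_lt_top (by simp) (by simp)]
  simpa using hp

lemma mul_le_sq_add_sq (s t : ℝ≥0∞) : s * t ≤ s ^ 2 + t ^ 2 := by
  rcases le_total s t with h | h
  · exact (mul_le_mul_left h t).trans ((pow_two t).symm.le.trans le_add_self)
  · exact (mul_le_mul_right h s).trans ((pow_two s).symm.le.trans le_self_add)

/-- The estimate $st\le s^2+t^2$ bounds the integral over $z$ by $\|u\|^2+\|\phi\|^2$ uniformly in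
$x$; integrability of $f$ does the rest. -/
lemma integrable_mul_translate_prod (u f : L2) (hf : Integrable f) (X : Set ℝ) :
    Integrable (fun r : ℝ × ℝ => starRingEnd ℂ (u r.2) * starRingEnd ℂ (φ (r.1 - r.2)) * f r.1)
      (volume.prod (volume.restrict X)) := by
  have hm : Measurable (fun r : ℝ × ℝ =>
      starRingEnd ℂ (u r.2) * starRingEnd ℂ (φ (r.1 - r.2)) * f r.1) :=
    ((RCLike.continuous_conj.measurable.comp ((measurable_L2 u).comp measurable_snd)).mul
      (RCLike.continuous_conj.measurable.comp
        ((measurable_L2 φ).comp (measurable_fst.sub measurable_snd)))).mul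
          ((measurable_L2 f).comp measurable_fst)
  have hi : Integrable (fun r : ℝ × ℝ =>
      starRingEnd ℂ (u r.2) * starRingEnd ℂ (φ (r.1 - r.2)) * f r.1) (volume.prod volume) := by
    refine ⟨hm.aestronglyMeasurable, ?_⟩
    rw [HasFiniteIntegral, lintegral_prod _ hm.enorm.aemeasurable]
    calc _ ≤ ∫⁻ x, (‖u‖ₑ ^ 2 + ‖φ‖ₑ ^ 2) * ‖f x‖ₑ := by
          refine lintegral_mono fun x => ?_
          have hu : Measurable fun z => ‖u z‖ₑ ^ 2 := (measurable_L2 u).enorm.pow_const 2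
          have hs : Measurable fun z => ‖u z‖ₑ ^ 2 + ‖φ (x - z)‖ₑ ^ 2 :=
            hu.add (measurable_reflect_sq φ x)
          simp only [enorm_mul, enorm_star_eq]
          calc _ ≤ ∫⁻ z, (‖u z‖ₑ ^ 2 + ‖φ (x - z)‖ₑ ^ 2) * ‖f x‖ₑ := by
                gcongr; exact mul_le_sq_add_sq _ _
            _ = _ := by
                rw [lintegral_mul_const _ hs, lintegral_add_left hu,
                  ← enorm_sq_eq_lintegral, lintegral_reflect_sq]
      _ < ∞ := by
          rw [lintegral_const_mul _ (measurable_L2 f).enorm]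
          exact ENNReal.mul_lt_top (by simp) hf.2
  refine hi.mono_measure ?_
  have hr := Measure.prod_restrict (μ := (volume : Measure ℝ)) (ν := (volume : Measure ℝ))
    Set.univ X
  rw [Measure.restrict_univ] at hr
  rw [hr]
  exact Measure.restrict_le_self

variable {φ}

/-- Insert the integral defining the multiplier and interchange the integrations. For $u=e_k$ the
result is a basis coefficient of $\chi_XW_f(\cdot,p)$. -/
lemma fourierPlancherel_krausOp (u f : L2) (hf : Integrable f) (X : Set ℝ) :
    fourierPlancherel (krausOp φ X u f) =ᵐ[volume]
      fun p => ∫ z in X, starRingEnd ℂ (u z) * windowedFourier φ f z p := by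
  have hc := krausOp_coeFn φ X u f
  have hi : Integrable (krausOp φ X u f) := by
    refine Integrable.congr ?_ hc.symm
    exact hf.bdd_mul (measurable_coef φ X u).aestronglyMeasurable
      (.of_forall fun x => norm_coef_le φ X u x)
  filter_upwards [fourierPlancherel_ae_eq _ hi] with p hp
  rw [hp]
  have e1 : ∫ x : ℝ, Complex.exp (-(Complex.I * p * x)) * krausOp φ X u f x =
      ∫ x : ℝ, ∫ z in X, Complex.exp (-(Complex.I * p * x)) *
        (starRingEnd ℂ (u z) * starRingEnd ℂ (φ (x - z)) * f x) := by
    refine integral_congr_ae ?_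
    filter_upwards [hc] with x hx
    rw [hx, coef, integral_const_mul, integral_mul_const]
  have hi2 : Integrable (fun r : ℝ × ℝ => Complex.exp (-(Complex.I * p * r.1)) *
      (starRingEnd ℂ (u r.2) * starRingEnd ℂ (φ (r.1 - r.2)) * f r.1))
      (volume.prod (volume.restrict X)) := by
    refine (integrable_mul_translate_prod φ u f hf X).bdd_mul (c := 1) ?_
      (.of_forall fun r => (norm_exp_neg_I_mul p r.1).le)
    exact Measurable.aestronglyMeasurable (by fun_prop)
  rw [e1, integral_integral_swap hi2, ← integral_const_mul]
  refine integral_congr_ae (.of_forall fun z => ?_)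
  simp only [windowedFourier]
  rw [mul_left_comm]
  congr 1
  rw [← integral_const_mul]
  refine integral_congr_ae (.of_forall fun x => ?_)
  simp only
  ring

end ShortTime

/-! ### Weyl relations and their action on the windowed transform. -/

section Weyl

lemma boost_coeFn (p : ℝ) (f : L2) :
    boost p f =ᵐ[volume] fun x : ℝ => Complex.exp (Complex.I * p * x) * f x := mulOp_coeFn _ _ f

lemma shift_coeFn (q : ℝ) (f : L2) : shift q f =ᵐ[volume] fun x => f (x - q) :=
  Lp.coeFn_compMeasurePreserving f (measurePreserving_sub_right volume q)

lemma ae_shift {P : ℝ → Prop} (q : ℝ) (h : ∀ᵐ x, P x) : ∀ᵐ x, P (x - q) :=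
  (measurePreserving_sub_right volume q).quasiMeasurePreserving.ae h

lemma boost_mul_boost (p p' : ℝ) : boost p * boost p' = boost (p + p') := by
  ext1 f
  apply Lp.ext
  filter_upwards [boost_coeFn p (boost p' f), boost_coeFn p' f, boost_coeFn (p + p') f]
    with x h1 h2 h3
  rw [mul_apply_eq_comp, h1, h2, h3, ← mul_assoc, ← Complex.exp_add]
  congr 2
  push_cast
  ring

lemma shift_mul_shift (q q' : ℝ) : shift q * shift q' = shift (q + q') := by
  ext1 f
  apply Lp.ext
  filter_upwards [shift_coeFn q (shift q' f), ae_shift q (shift_coeFn q' f),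
    shift_coeFn (q + q') f] with x h1 h2 h3
  rw [mul_apply_eq_comp, h1, h2, h3, sub_sub]

lemma boost_zero : boost 0 = 1 := by
  ext1 f
  apply Lp.ext
  filter_upwards [boost_coeFn 0 f] with x h1
  rw [h1]
  simp

lemma boost_mul_shift (p q : ℝ) :
    boost p * shift q = Complex.exp (Complex.I * p * q) • (shift q * boost p) := by
  ext1 f
  apply Lp.ext
  rw [smul_apply, mul_apply_eq_comp, mul_apply_eq_comp]
  filter_upwards [boost_coeFn p (shift q f), shift_coeFn q f, shift_coeFn q (boost p f),
    ae_shift q (boost_coeFn p f),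
    Lp.coeFn_smul (Complex.exp (Complex.I * p * q)) (shift q (boost p f))] with x h1 h2 h3 h4 h5
  rw [h1, h2, h5, Pi.smul_apply, h3, h4, smul_eq_mul, ← mul_assoc, ← Complex.exp_add]
  congr 2
  push_cast
  ring

lemma star_boost (p : ℝ) : star (boost p) = boost (-p) := by
  rw [ContinuousLinearMap.star_eq_adjoint, eq_comm, ContinuousLinearMap.eq_adjoint_iff]
  intro f g
  rw [← inner_conj_symm, boost, boost, inner_mulOp, inner_mulOp, ← integral_conj]
  refine integral_congr_ae (.of_forall fun x => ?_)
  simp only [map_mul, inner_conj_symm, ← Complex.exp_conj, Complex.conj_I, Complex.conj_ofReal,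
    Complex.ofReal_neg, map_neg]
  congr 2
  ring

/-- The operator `U_q V_p` for `z = (q, p)`. -/
def weyl (z : ℝ × ℝ) : L2 →L[ℂ] L2 := shift z.1 * boost z.2

lemma star_weyl (z : ℝ × ℝ) : star (weyl z) = star (boost z.2) * star (shift z.1) := star_mul _ _

lemma weyl_mul_weyl (z w : ℝ × ℝ) :
    weyl z * weyl w = Complex.exp (Complex.I * z.2 * w.1) • weyl (z + w) := by
  simp only [weyl, Prod.fst_add, Prod.snd_add]
  rw [mul_assoc, ← mul_assoc (boost z.2), boost_mul_shift, smul_mul_assoc, mul_smul_comm,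
    mul_assoc (shift w.1), boost_mul_boost, ← mul_assoc, shift_mul_shift]

lemma norm_exp_I_mul (p x : ℝ) : ‖Complex.exp (Complex.I * p * x)‖ = 1 := by
  have : Complex.I * p * x = ((p * x : ℝ) : ℂ) * Complex.I := by push_cast; ring
  rw [this, Complex.norm_exp_ofReal_mul_I]

lemma norm_boost (p : ℝ) (f : L2) : ‖boost p f‖ = ‖f‖ := by
  refine (boost p).norm_map_iff_adjoint_comp_self.2 ?_ f
  rw [← ContinuousLinearMap.star_eq_adjoint, star_boost]
  exact (boost_mul_boost (-p) p).trans (by rw [neg_add_cancel, boost_zero])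

lemma continuous_inner_boost (f g : L2) : Continuous fun p => ⟪g, boost p f⟫_ℂ := by
  simp only [boost, inner_mulOp]
  refine continuous_of_dominated (bound := fun x => ‖⟪g x, f x⟫_ℂ‖) (fun p => ?_)
    (fun p => .of_forall fun x => ?_) (L2.integrable_inner (𝕜 := ℂ) g f).norm
    (.of_forall fun x => by fun_prop)
  · exact (memLp_boost p).aestronglyMeasurable.mul
      (L2.integrable_inner (𝕜 := ℂ) g f).aestronglyMeasurable
  · rw [norm_mul, norm_exp_I_mul, one_mul]

/-- Weak continuity suffices because boosts preserve norms:
$\|V_pf-V_{p_0}f\|^2=2\|f\|^2-2\,\mathrm{Re}\langle V_{p_0}f,V_pf\rangle$. -/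
lemma continuous_boost (f : L2) : Continuous fun p => boost p f := by
  refine continuous_iff_continuousAt.2 fun p₀ => ?_
  rw [ContinuousAt, tendsto_iff_norm_sub_tendsto_zero]
  have h : ∀ p, ‖boost p f - boost p₀ f‖ =
      √(2 * ‖f‖ ^ 2 - 2 * (⟪boost p₀ f, boost p f⟫_ℂ).re) := fun p => by
    have h1 := norm_sub_sq (𝕜 := ℂ) (boost p₀ f) (boost p f)
    rw [norm_boost, norm_boost, norm_sub_rev] at h1
    rw [← Real.sqrt_sq (norm_nonneg (boost p f - boost p₀ f)), h1]
    congr 1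
    change ‖f‖ ^ 2 - 2 * (⟪boost p₀ f, boost p f⟫_ℂ).re + ‖f‖ ^ 2 = _
    ring
  simp only [h]
  have hc : Continuous fun p => √(2 * ‖f‖ ^ 2 - 2 * (⟪boost p₀ f, boost p f⟫_ℂ).re) := by
    have := Complex.continuous_re.comp (continuous_inner_boost f (boost p₀ f))
    fun_prop
  have := hc.tendsto p₀
  rwa [← h p₀, sub_self, norm_zero] at this

variable (φ : L2)

lemma sqrt_two_pi_ne_zero : (√(2 * Real.pi) : ℂ) ≠ 0 := by
  exact_mod_cast (Real.sqrt_pos.2 (by positivity : (0 : ℝ) < 2 * Real.pi)).ne'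

/-- The phase $e^{ipq}$ arises since $U_qV_p$ boosts before it shifts. -/
lemma inner_weyl (f : L2) (z : ℝ × ℝ) : ⟪weyl z φ, f⟫_ℂ =
    √(2 * Real.pi) * Complex.exp (Complex.I * z.2 * z.1) * windowedFourier φ f z.1 z.2 := by
  rw [windowedFourier, mul_comm (√(2 * Real.pi) : ℂ), mul_assoc,
    mul_inv_cancel_left₀ sqrt_two_pi_ne_zero, L2.inner_def, ← integral_const_mul]
  refine integral_congr_ae ?_
  filter_upwards [shift_coeFn z.1 (boost z.2 φ), ae_shift z.1 (boost_coeFn z.2 φ)] with x h1 h2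
  rw [weyl, mul_apply_eq_comp, h1, h2]
  simp only [RCLike.inner_apply, map_mul, ← Complex.exp_conj, Complex.conj_I, Complex.conj_ofReal]
  rw [← mul_assoc (Complex.exp _), ← Complex.exp_add, mul_comm (f x), mul_assoc]
  congr 2
  push_cast
  ring

lemma enorm_inner_weyl (f : L2) (z : ℝ × ℝ) : ‖⟪weyl z φ, f⟫_ℂ‖ₑ =
    ENNReal.ofReal √(2 * Real.pi) * ‖windowedFourier φ f z.1 z.2‖ₑ := by
  rw [inner_weyl, enorm_mul, enorm_mul, ← ofReal_norm (Complex.exp _), norm_exp_I_mul,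
    ← ofReal_norm, Complex.norm_real, Real.norm_of_nonneg (Real.sqrt_nonneg _)]
  simp

/-- Products of Weyl operators are Weyl operators up to a phase, which the modulus forgets;
covariance of $G$ rests on this. -/
lemma enorm_windowedFourier_star_weyl (f : L2) (z w : ℝ × ℝ) :
    ‖windowedFourier φ (star (weyl w) f) z.1 z.2‖ₑ =
      ‖windowedFourier φ f (z + w).1 (z + w).2‖ₑ := by
  have h : ‖⟪weyl z φ, star (weyl w) f⟫_ℂ‖ₑ = ‖⟪weyl (z + w) φ, f⟫_ℂ‖ₑ := by
    rw [ContinuousLinearMap.star_eq_adjoint, ContinuousLinearMap.adjoint_inner_right,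
      ← mul_apply_eq_comp, weyl_mul_weyl, smul_apply, inner_smul_left, enorm_mul, enorm_star_eq,
      ← ofReal_norm (Complex.exp _), norm_exp_I_mul, ENNReal.ofReal_one, one_mul, add_comm]
  rw [enorm_inner_weyl, enorm_inner_weyl] at h
  refine (ENNReal.mul_right_inj ?_ ENNReal.ofReal_ne_top).1 h
  rw [Ne, ENNReal.ofReal_eq_zero, not_le]
  positivity

end Weyl

/-! ### The mixture $T$ is a state. -/

section GeneratingState

variable (φ : L2) (ν : Measure ℝ) [IsProbabilityMeasure ν]

lemma star_boost_mul_rankOne (x : ℝ) : star (boost x) * rankOne ℂ φ φ * boost x =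
    rankOne ℂ (boost (-x) φ) (boost (-x) φ) := by
  have h := mul_rankOne_mul_star (boost (-x)) φ φ
  rw [star_boost (-x), neg_neg] at h
  rw [star_boost x, h]

lemma continuous_boost_neg : Continuous fun x => boost (-x) φ :=
  (continuous_boost φ).comp continuous_neg

omit [IsProbabilityMeasure ν] in
lemma generatingState_eq :
    generatingState φ ν = ∫ x, rankOne ℂ (boost (-x) φ) (boost (-x) φ) ∂ν := by
  simp only [generatingState, star_boost_mul_rankOne]

lemma integrable_rankOne_boost :
    Integrable (fun x => rankOne ℂ (boost (-x) φ) (boost (-x) φ)) ν := by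
  have hc : Continuous fun x => rankOne ℂ (boost (-x) φ) (boost (-x) φ) :=
    ((ContinuousLinearMap.smulRightL ℂ L2 L2).continuous.comp
      ((innerSL ℂ).continuous.comp (continuous_boost_neg φ))).clm_apply (continuous_boost_neg φ)
  refine (integrable_const (‖φ‖ * ‖φ‖)).mono' hc.aestronglyMeasurable (.of_forall fun x => ?_)
  rw [norm_rankOne, norm_boost]

lemma inner_generatingState (f g : L2) : ⟪f, generatingState φ ν g⟫_ℂ =
    ∫ x, starRingEnd ℂ ⟪boost (-x) φ, f⟫_ℂ * ⟪boost (-x) φ, g⟫_ℂ ∂ν := by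
  have h := integrable_rankOne_boost φ ν
  rw [generatingState_eq, ContinuousLinearMap.integral_apply h,
    ← integral_inner (h.apply_continuousLinearMap g)]
  refine integral_congr_ae (.of_forall fun x => ?_)
  simp [inner_smul_right, mul_comm]

lemma inner_generatingState_self (f : L2) : ⟪f, generatingState φ ν f⟫_ℂ =
    ((∫⁻ x, ‖⟪boost (-x) φ, f⟫_ℂ‖ₑ ^ 2 ∂ν).toReal : ℂ) := by
  rw [inner_generatingState, integral_conj_mul_self]
  exact ((continuous_boost_neg φ).inner continuous_const).aestronglyMeasurable

lemma generatingState_nonneg : 0 ≤ generatingState φ ν := by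
  refine nonneg_of_forall_inner_nonneg fun f => ?_
  rw [inner_generatingState_self]
  exact_mod_cast ENNReal.toReal_nonneg

variable {φ}

/-- Tonelli exchanges the basis sum with the integral over $\nu$, and Parseval gives
$\|V_{-x}\phi\|^2=1$ for each $x$. -/
lemma hasSum_generatingState (hφ : ‖φ‖ = 1) {κ : Type*} [Countable κ] (e : HilbertBasis κ ℂ L2) :
    HasSum (fun k => (⟪e k, generatingState φ ν (e k)⟫_ℂ).re) 1 := by
  simp only [inner_generatingState_self, Complex.ofReal_re]
  have h : ∑' k, ∫⁻ x, ‖⟪boost (-x) φ, e k⟫_ℂ‖ₑ ^ 2 ∂ν = 1 := by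
    have hm : ∀ k, AEMeasurable (fun x => ‖⟪boost (-x) φ, e k⟫_ℂ‖ₑ ^ 2) ν := fun k =>
      (((continuous_boost_neg φ).inner continuous_const).measurable.enorm.pow_const 2).aemeasurable
    rw [← lintegral_tsum hm]
    have h1 : ∀ x, ∑' k, ‖⟪boost (-x) φ, e k⟫_ℂ‖ₑ ^ 2 = 1 := fun x => by
      have h2 : ∀ k, ‖⟪boost (-x) φ, e k⟫_ℂ‖ₑ = ‖⟪e k, boost (-x) φ⟫_ℂ‖ₑ := fun k => by
        rw [← inner_conj_symm, enorm_star_eq]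
      simp only [h2, tsum_enorm_inner_sq]
      rw [← ofReal_norm, norm_boost, hφ, ENNReal.ofReal_one, one_pow]
    simp [h1]
  have h3 := ENNReal.hasSum_toReal (h ▸ ENNReal.one_ne_top)
  have hne : ∀ k, ∫⁻ x, ‖⟪boost (-x) φ, e k⟫_ℂ‖ₑ ^ 2 ∂ν ≠ ∞ :=
    ENNReal.ne_top_of_tsum_ne_top (h ▸ ENNReal.one_ne_top)
  rwa [← ENNReal.tsum_toReal_eq hne, h, ENNReal.toReal_one] at h3

lemma isState_generatingState (hφ : ‖φ‖ = 1) : IsState (generatingState φ ν) := by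
  obtain ⟨w, e, hw⟩ := exists_countable_hilbertBasis
  have hs := hasSum_generatingState ν hφ e
  have hm := mem_traceClass_of_summable (generatingState_nonneg φ ν) e hs.summable
  refine ⟨generatingState_nonneg φ ν, hm, (hasSum_trace_of_mem hm e).unique ?_⟩
  rw [← Complex.ofReal_one]
  refine ((Complex.hasSum_ofReal).2 hs).congr_fun fun k => ?_
  rw [inner_generatingState_self, Complex.ofReal_re]

end GeneratingState

/-! ### The phase space density. -/

section PhaseSpace

variable (φ : L2) (ν : Measure ℝ)

/-- The density of `Z ↦ ⟨f, G(Z) g⟩`. -/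
def phaseDensity (f g : L2) (z : ℝ × ℝ) : ℂ :=
  ∫ t, starRingEnd ℂ (windowedFourier φ f z.1 (z.2 - t)) * windowedFourier φ g z.1 (z.2 - t) ∂ν

variable [IsProbabilityMeasure ν]

/-- The density of `Z ↦ ⟨f, G(Z) f⟩`. -/
def phaseWeight (f : L2) (z : ℝ × ℝ) : ℝ≥0∞ :=
  ∫⁻ t, ‖windowedFourier φ f z.1 (z.2 - t)‖ₑ ^ 2 ∂ν

lemma measurable_windowedFourier_sub (f : L2) :
    Measurable fun r : (ℝ × ℝ) × ℝ => windowedFourier φ f r.1.1 (r.1.2 - r.2) := by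
  have h : Measurable fun r : (ℝ × ℝ) × ℝ => (r.1.1, r.1.2 - r.2) := by fun_prop
  have h' := (measurable_windowedFourier φ f).comp h
  exact h'

lemma measurable_windowedFourier_sub_right (f : L2) (z : ℝ × ℝ) :
    Measurable fun t => windowedFourier φ f z.1 (z.2 - t) := by
  have h : Measurable fun t : ℝ => (z, t) := by fun_prop
  have h' := (measurable_windowedFourier_sub φ f).comp h
  exact h'

lemma measurable_phaseWeight (f : L2) : Measurable (phaseWeight φ ν f) :=
  ((measurable_windowedFourier_sub φ f).enorm.pow_const 2).lintegral_prod_right'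

lemma measurable_phaseDensity (f g : L2) : Measurable (phaseDensity φ ν f g) := by
  have h : StronglyMeasurable fun r : (ℝ × ℝ) × ℝ =>
      starRingEnd ℂ (windowedFourier φ f r.1.1 (r.1.2 - r.2)) *
        windowedFourier φ g r.1.1 (r.1.2 - r.2) :=
    ((RCLike.continuous_conj.measurable.comp (measurable_windowedFourier_sub φ f)).mul
      (measurable_windowedFourier_sub φ g)).stronglyMeasurable
  exact h.integral_prod_right'.measurable

omit [IsProbabilityMeasure ν] in
lemma phaseDensity_self (f : L2) (z : ℝ × ℝ) :
    phaseDensity φ ν f f z = ((phaseWeight φ ν f z).toReal : ℂ) :=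
  integral_conj_mul_self (measurable_windowedFourier_sub_right φ f z).aestronglyMeasurable

omit [IsProbabilityMeasure ν] in
lemma enorm_phaseDensity_le (f g : L2) (z : ℝ × ℝ) :
    ‖phaseDensity φ ν f g z‖ₑ ≤ phaseWeight φ ν f z + phaseWeight φ ν g z := by
  have hm : Measurable fun t => ‖windowedFourier φ f z.1 (z.2 - t)‖ₑ ^ 2 :=
    (measurable_windowedFourier_sub_right φ f z).enorm.pow_const 2
  refine (enorm_integral_le_lintegral_enorm _).trans ?_
  rw [phaseWeight, phaseWeight, ← lintegral_add_left hm]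
  refine lintegral_mono fun t => ?_
  rw [enorm_mul, enorm_star_eq]
  exact mul_le_sq_add_sq _ _

/-- The substitution $p\mapsto p+t$ moves the convolution with $\nu$ from the density onto the
indicator of $Y$, whose $\nu$-integral is the smeared indicator of $P_\nu$. -/
lemma lintegral_phaseWeight_prod (f : L2) {X Y : Set ℝ} (hY : MeasurableSet Y) :
    ∫⁻ z in X ×ˢ Y, phaseWeight φ ν f z =
      ∫⁻ p, ν ((fun t => t + p) ⁻¹' Y) * ∫⁻ q in X, ‖windowedFourier φ f q p‖ₑ ^ 2 := by
  have hw : Measurable fun z : ℝ × ℝ => ‖windowedFourier φ f z.1 z.2‖ₑ ^ 2 :=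
    (measurable_windowedFourier φ f).enorm.pow_const 2
  have hY1 : Measurable (Y.indicator (1 : ℝ → ℝ≥0∞)) := measurable_one.indicator hY
  have hsm : Measurable fun p : ℝ => ν ((fun t => t + p) ⁻¹' Y) :=
    measurable_measure_prodMk_left (ν := ν) ((measurable_snd.add measurable_fst) hY)
  have key : ∀ q, ∫⁻ p in Y, phaseWeight φ ν f (q, p) =
      ∫⁻ p, ν ((fun t => t + p) ⁻¹' Y) * ‖windowedFourier φ f q p‖ₑ ^ 2 := by
    intro q
    have h1 : Measurable fun r : ℝ × ℝ =>
        Y.indicator (1 : ℝ → ℝ≥0∞) r.1 * ‖windowedFourier φ f q (r.1 - r.2)‖ₑ ^ 2 := by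
      have h : Measurable fun r : ℝ × ℝ => (q, r.1 - r.2) := by fun_prop
      have h' := (hY1.comp measurable_fst).mul (hw.comp h)
      exact h'
    have h2 : Measurable fun r : ℝ × ℝ =>
        Y.indicator (1 : ℝ → ℝ≥0∞) (r.2 + r.1) * ‖windowedFourier φ f q r.2‖ₑ ^ 2 := by
      have h : Measurable fun r : ℝ × ℝ => (q, r.2) := by fun_prop
      have h' : Measurable fun r : ℝ × ℝ => r.2 + r.1 := by fun_prop
      have h'' := (hY1.comp h').mul (hw.comp h)
      exact h''
    calc ∫⁻ p in Y, phaseWeight φ ν f (q, p)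
        = ∫⁻ p, ∫⁻ t, Y.indicator (1 : ℝ → ℝ≥0∞) p *
            ‖windowedFourier φ f q (p - t)‖ₑ ^ 2 ∂ν := by
          rw [← lintegral_indicator hY]
          refine lintegral_congr fun p => ?_
          by_cases hp : p ∈ Y <;> simp [hp, phaseWeight]
      _ = ∫⁻ t, (∫⁻ p, Y.indicator (1 : ℝ → ℝ≥0∞) p *
            ‖windowedFourier φ f q (p - t)‖ₑ ^ 2) ∂ν :=
          lintegral_lintegral_swap h1.aemeasurable
      _ = ∫⁻ t, (∫⁻ p, Y.indicator (1 : ℝ → ℝ≥0∞) (p + t) *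
            ‖windowedFourier φ f q p‖ₑ ^ 2) ∂ν := by
          refine lintegral_congr fun t => ?_
          rw [← lintegral_add_right_eq_self _ t]
          simp
      _ = ∫⁻ p, ∫⁻ t, Y.indicator (1 : ℝ → ℝ≥0∞) (p + t) *
            ‖windowedFourier φ f q p‖ₑ ^ 2 ∂ν := lintegral_lintegral_swap h2.aemeasurable
      _ = _ := by
          refine lintegral_congr fun p => ?_
          have h : Measurable fun t => p + t := by fun_prop
          have h' : Measurable fun t => Y.indicator (1 : ℝ → ℝ≥0∞) (p + t) := hY1.comp h
          have h'' : Measurable fun t => t + p := by fun_prop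
          rw [lintegral_mul_const _ h', ← lintegral_indicator_one (h'' hY)]
          congr 1
          refine lintegral_congr fun t => ?_
          rw [add_comm p t]
          rfl
  have h3 : Measurable fun r : ℝ × ℝ =>
      ν ((fun t => t + r.2) ⁻¹' Y) * ‖windowedFourier φ f r.1 r.2‖ₑ ^ 2 :=
    (hsm.comp measurable_snd).mul hw
  have h4 : ∀ p, Measurable fun q : ℝ => ‖windowedFourier φ f q p‖ₑ ^ 2 := fun p => by
    have h : Measurable fun q : ℝ => (q, p) := by fun_prop
    have h' := hw.comp h
    exact h'
  rw [Measure.volume_eq_prod, ← Measure.prod_restrict,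
    lintegral_prod _ (measurable_phaseWeight φ ν f).aemeasurable]
  simp only [key]
  rw [lintegral_lintegral_swap h3.aemeasurable]
  refine lintegral_congr fun p => ?_
  rw [lintegral_const_mul _ (h4 p)]

lemma lintegral_phaseWeight (f : L2) : ∫⁻ z, phaseWeight φ ν f z = ‖φ‖ₑ ^ 2 * ‖f‖ₑ ^ 2 := by
  have hw : Measurable fun z : ℝ × ℝ => ‖windowedFourier φ f z.1 z.2‖ₑ ^ 2 :=
    (measurable_windowedFourier φ f).enorm.pow_const 2
  rw [← lintegral_lintegral_windowedFourier_sq, lintegral_lintegral_swap hw.aemeasurable]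
  have := lintegral_phaseWeight_prod φ ν f (X := Set.univ) MeasurableSet.univ
  simpa using this

lemma lintegral_phaseWeight_ne_top (f : L2) (Z : Set (ℝ × ℝ)) :
    ∫⁻ z in Z, phaseWeight φ ν f z ≠ ∞ := by
  refine ne_top_of_le_ne_top ?_ (setLIntegral_le_lintegral Z _)
  rw [lintegral_phaseWeight]
  exact ENNReal.mul_ne_top (by simp) (by simp)

lemma integrable_phaseDensity (f g : L2) : Integrable (phaseDensity φ ν f g) := by
  refine ⟨(measurable_phaseDensity φ ν f g).aestronglyMeasurable, ?_⟩
  refine (lintegral_mono (enorm_phaseDensity_le φ ν f g)).trans_lt ?_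
  rw [lintegral_add_left (measurable_phaseWeight φ ν f), lintegral_phaseWeight,
    lintegral_phaseWeight]
  exact ENNReal.add_lt_top.2 ⟨ENNReal.mul_lt_top (by simp) (by simp),
    ENNReal.mul_lt_top (by simp) (by simp)⟩

lemma integral_phaseDensity_self (f : L2) (Z : Set (ℝ × ℝ)) :
    ∫ z in Z, phaseDensity φ ν f f z = ((∫⁻ z in Z, phaseWeight φ ν f z).toReal : ℂ) := by
  simp only [phaseDensity_self]
  rw [integral_complex_ofReal, integral_toReal (measurable_phaseWeight φ ν f).aemeasurable
    (ae_lt_top (measurable_phaseWeight φ ν f) (lintegral_phaseWeight_ne_top φ ν f Z))]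

/-- $U_qV_pV_{-t}\phi=U_qV_{p-t}\phi$, so conjugating the mixture only translates the momentum
argument of the windowed transform by $t$. -/
lemma inner_weyl_generatingState (f g : L2) (z : ℝ × ℝ) :
    ⟪f, (shift z.1 * boost z.2 * generatingState φ ν * star (boost z.2) * star (shift z.1)) g⟫_ℂ =
      2 * Real.pi * phaseDensity φ ν f g z := by
  have h1 : shift z.1 * boost z.2 * generatingState φ ν * star (boost z.2) * star (shift z.1) =
      weyl z * generatingState φ ν * star (weyl z) := by
    rw [star_weyl, weyl]; simp only [mul_assoc]
  have h2 : ∀ (t : ℝ) (h : L2), ⟪boost (-t) φ, star (weyl z) h⟫_ℂ =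
      √(2 * Real.pi) * Complex.exp (Complex.I * (z.2 - t : ℝ) * z.1) *
        windowedFourier φ h z.1 (z.2 - t) := fun t h => by
    rw [← inner_weyl φ h (z.1, z.2 - t), ContinuousLinearMap.star_eq_adjoint,
      ContinuousLinearMap.adjoint_inner_right, weyl, weyl, mul_apply_eq_comp, mul_apply_eq_comp,
      ← mul_apply_eq_comp (boost z.2), boost_mul_boost, sub_eq_add_neg]
  rw [h1, mul_apply_eq_comp, mul_apply_eq_comp, ← ContinuousLinearMap.adjoint_inner_left,
    ← ContinuousLinearMap.star_eq_adjoint, inner_generatingState, phaseDensity,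
    ← integral_const_mul]
  refine integral_congr_ae (.of_forall fun t => ?_)
  simp only [h2, map_mul, Complex.conj_ofReal]
  -- The factors for $f$ and $g$ carry the same phase, once conjugated, and $2\pi$ is the product of
  -- the two normalizations.
  have h3 : starRingEnd ℂ (Complex.exp (Complex.I * (z.2 - t : ℝ) * z.1)) *
      Complex.exp (Complex.I * (z.2 - t : ℝ) * z.1) = 1 := by
    rw [Complex.conj_mul', norm_exp_I_mul]; simp
  have h4 : (√(2 * Real.pi) : ℂ) * √(2 * Real.pi) = 2 * Real.pi := by
    rw [← Complex.ofReal_mul, Real.mul_self_sqrt (by positivity)]; push_cast; ring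
  linear_combination (starRingEnd ℂ (windowedFourier φ f z.1 (z.2 - t)) *
    windowedFourier φ g z.1 (z.2 - t)) * (h4 + (√(2 * Real.pi) : ℂ) * √(2 * Real.pi) * h3)

end PhaseSpace

/-! ### The observable $G_T$ and its covariance. -/

section PhaseObservable

/-- Apply the hypothesis to the normalized vectors. The bound available for the phase form is a sum
of squares, while a bounded form needs a product. -/
lemma norm_sesq_le_of_sq {H : Type*} [NormedAddCommGroup H] [InnerProductSpace ℂ H]
    (B : H →ₗ⋆[ℂ] H →ₗ[ℂ] ℂ) {C : ℝ} (h : ∀ x y, ‖B x y‖ ≤ C * (‖x‖ ^ 2 + ‖y‖ ^ 2)) (x y : H) :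
    ‖B x y‖ ≤ 2 * C * ‖x‖ * ‖y‖ := by
  rcases eq_or_ne x 0 with rfl | hx
  · simp
  rcases eq_or_ne y 0 with rfl | hy
  · simp
  have hx' : 0 < ‖x‖ := norm_pos_iff.2 hx
  have hy' : 0 < ‖y‖ := norm_pos_iff.2 hy
  have h1 := h (((‖x‖⁻¹ : ℝ) : ℂ) • x) (((‖y‖⁻¹ : ℝ) : ℂ) • y)
  simp only [map_smulₛₗ, LinearMap.smul_apply, norm_smul, Complex.norm_real, norm_inv, norm_norm,
    Complex.conj_ofReal, RingHom.id_apply, smul_eq_mul, norm_mul] at h1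
  rw [inv_mul_cancel₀ hx'.ne', inv_mul_cancel₀ hy'.ne'] at h1
  calc ‖B x y‖ = ‖y‖⁻¹ * (‖x‖⁻¹ * ‖B x y‖) * (‖x‖ * ‖y‖) := by field_simp
    _ ≤ C * (1 ^ 2 + 1 ^ 2) * (‖x‖ * ‖y‖) := by
        refine mul_le_mul_of_nonneg_right (le_trans (le_of_eq ?_) h1) (by positivity)
        ring
    _ = _ := by ring

variable (φ : L2) (ν : Measure ℝ) [IsProbabilityMeasure ν]

/-- Written as a matrix element, the density is visibly sesquilinear, with no integrability in $t$
to check. -/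
lemma phaseDensity_eq (f g : L2) (z : ℝ × ℝ) : phaseDensity φ ν f g z =
    (1 / (2 * Real.pi) : ℂ) * ⟪f, (shift z.1 * boost z.2 * generatingState φ ν *
      star (boost z.2) * star (shift z.1)) g⟫_ℂ := by
  have : (Real.pi : ℂ) ≠ 0 := by exact_mod_cast Real.pi_ne_zero
  rw [inner_weyl_generatingState]
  field_simp

/-- The sesquilinear form `(f, g) ↦ ⟨f, G(Z) g⟩`. -/
def phaseForm (Z : Set (ℝ × ℝ)) : L2 →ₗ⋆[ℂ] L2 →ₗ[ℂ] ℂ :=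
  LinearMap.mk₂'ₛₗ (starRingEnd ℂ) (RingHom.id ℂ) (fun f g => ∫ z in Z, phaseDensity φ ν f g z)
    (fun f f' g => by
      rw [← integral_add (integrable_phaseDensity φ ν f g).integrableOn
        (integrable_phaseDensity φ ν f' g).integrableOn]
      simp only [phaseDensity_eq, inner_add_left, mul_add])
    (fun c f g => by
      rw [smul_eq_mul, ← integral_const_mul]
      simp only [phaseDensity_eq, inner_smul_left, mul_left_comm])
    (fun f g g' => by
      rw [← integral_add (integrable_phaseDensity φ ν f g).integrableOn
        (integrable_phaseDensity φ ν f g').integrableOn]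
      simp only [phaseDensity_eq, map_add, inner_add_right, mul_add])
    (fun c f g => by
      rw [smul_eq_mul, ← integral_const_mul]
      simp only [phaseDensity_eq, map_smul, inner_smul_right, mul_left_comm, RingHom.id_apply])

lemma norm_phaseForm_le (Z : Set (ℝ × ℝ)) (f g : L2) :
    ‖phaseForm φ ν Z f g‖ ≤ ‖φ‖ ^ 2 * (‖f‖ ^ 2 + ‖g‖ ^ 2) := by
  have h : ‖∫ z in Z, phaseDensity φ ν f g z‖ₑ ≤
      ENNReal.ofReal (‖φ‖ ^ 2 * (‖f‖ ^ 2 + ‖g‖ ^ 2)) := by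
    refine (enorm_integral_le_lintegral_enorm _).trans ((setLIntegral_le_lintegral Z _).trans
      ((lintegral_mono (enorm_phaseDensity_le φ ν f g)).trans_eq ?_))
    rw [lintegral_add_left (measurable_phaseWeight φ ν f), lintegral_phaseWeight,
      lintegral_phaseWeight, ENNReal.ofReal_mul (by positivity),
      ENNReal.ofReal_add (by positivity) (by positivity)]
    simp only [ENNReal.ofReal_pow (norm_nonneg _), ofReal_norm, mul_add]
  rw [← ofReal_norm] at h
  exact (ENNReal.ofReal_le_ofReal_iff (by positivity)).1 h

/-- The operator `G(Z) = (2π)⁻¹ ∫_Z U_q V_p T V_p* U_q* dq dp`. -/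
def phaseOp (Z : Set (ℝ × ℝ)) : L2 →L[ℂ] L2 :=
  formOp ((phaseForm φ ν Z).mkContinuous₂ (2 * ‖φ‖ ^ 2)
    (norm_sesq_le_of_sq _ (norm_phaseForm_le φ ν Z)))

lemma inner_phaseOp (Z : Set (ℝ × ℝ)) (f g : L2) :
    ⟪f, phaseOp φ ν Z g⟫_ℂ = ∫ z in Z, phaseDensity φ ν f g z := by
  rw [phaseOp, inner_formOp]
  rfl

lemma inner_phaseOp_self (Z : Set (ℝ × ℝ)) (f : L2) :
    ⟪f, phaseOp φ ν Z f⟫_ℂ = ((∫⁻ z in Z, phaseWeight φ ν f z).toReal : ℂ) := by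
  rw [inner_phaseOp, integral_phaseDensity_self]

variable {φ}

lemma phaseOp_univ (hφ : ‖φ‖ = 1) : phaseOp φ ν Set.univ = 1 := by
  refine eq_of_forall_inner_self fun f => ?_
  rw [inner_phaseOp_self, Measure.restrict_univ, lintegral_phaseWeight, one_apply_eq_self,
    inner_self_eq_norm_sq_to_K]
  simp [hφ]

open Classical in
/-- The observable `G_T` for `T = ∫ V_x* P_φ V_x dν(x)`. -/
def phaseObservable (hφ : ‖φ‖ = 1) : Observable L2 (ℝ × ℝ) where
  toFun Z := if MeasurableSet Z then phaseOp φ ν Z else 0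
  not_measurable' Z hZ := by simp [hZ]
  nonneg' Z hZ := by
    rw [if_pos hZ]
    refine nonneg_of_forall_inner_nonneg fun f => ?_
    rw [inner_phaseOp_self]
    exact_mod_cast ENNReal.toReal_nonneg
  le_one' Z hZ := by
    rw [if_pos hZ, ← sub_nonneg, ← phaseOp_univ ν hφ]
    refine nonneg_of_forall_inner_nonneg fun f => ?_
    rw [sub_apply, inner_sub_right, inner_phaseOp_self, inner_phaseOp_self, sub_nonneg]
    exact_mod_cast ENNReal.toReal_mono (lintegral_phaseWeight_ne_top φ ν f _)
      (lintegral_mono_set (Set.subset_univ Z))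
  univ' := by rw [if_pos MeasurableSet.univ, phaseOp_univ ν hφ]
  hasSum' Z hZ hd f g := by
    simp only [hZ, MeasurableSet.iUnion hZ, if_true, inner_phaseOp]
    exact hasSum_integral_iUnion hZ hd (integrable_phaseDensity φ ν f g).integrableOn

lemma phaseObservable_apply (hφ : ‖φ‖ = 1) {Z : Set (ℝ × ℝ)} (hZ : MeasurableSet Z) :
    phaseObservable ν hφ Z = phaseOp φ ν Z := if_pos hZ

lemma isGeneratedBy_phaseObservable (hφ : ‖φ‖ = 1) :
    IsGeneratedBy (phaseObservable ν hφ) (generatingState φ ν) := by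
  intro Z hZ f g
  constructor
  · simp only [inner_weyl_generatingState]
    exact ((integrable_phaseDensity φ ν f g).const_mul _).integrableOn
  · rw [phaseObservable_apply ν hφ hZ, inner_phaseOp, ← integral_const_mul]
    simp only [phaseDensity_eq]

/-- On quadratic forms, the Weyl operator translates the density by $(q,p)$, and Lebesgue measure is
translation invariant. -/
lemma isCovariantPhaseSpace_phaseObservable (hφ : ‖φ‖ = 1) :
    IsCovariantPhaseSpace (phaseObservable ν hφ) := by
  intro q p Z hZ
  have hemb : MeasurableEmbedding fun z : ℝ × ℝ => z + (q, p) := measurableEmbedding_addRight _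
  rw [phaseObservable_apply ν hφ hZ, phaseObservable_apply ν hφ (hemb.measurableSet_image.2 hZ)]
  have h1 : shift q * boost p * phaseOp φ ν Z * star (boost p) * star (shift q) =
      weyl (q, p) * phaseOp φ ν Z * star (weyl (q, p)) := by
    rw [star_weyl, weyl]; simp only [mul_assoc]
  refine eq_of_forall_inner_self fun f => ?_
  have h2 : ∀ z, phaseWeight φ ν (star (weyl (q, p)) f) z = phaseWeight φ ν f (z + (q, p)) := by
    intro z
    simp only [phaseWeight]
    refine lintegral_congr fun t => ?_
    rw [enorm_windowedFourier_star_weyl φ f (z.1, z.2 - t) (q, p)]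
    simp only [Prod.fst_add, Prod.snd_add, sub_add_eq_add_sub]
  rw [h1, mul_apply_eq_comp, mul_apply_eq_comp, ← ContinuousLinearMap.adjoint_inner_left,
    ← ContinuousLinearMap.star_eq_adjoint, inner_phaseOp_self, inner_phaseOp_self]
  simp only [h2]
  rw [(measurePreserving_add_right volume (q, p)).setLIntegral_comp_emb hemb]

end PhaseObservable

/-! ### $G_T$ is a joint observable of the sequential measurement. -/

section Sequential

variable {φ : L2} {X Y : Set ℝ} {κ : Type*} (e : HilbertBasis κ ℂ L2)

lemma tsum_enorm_integral_windowedFourier (hX : MeasurableSet X) (f : L2) {p : ℝ}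
    (hp : MemLp (fun q => windowedFourier φ f q p) 2 volume) :
    ∑' k, ‖∫ z in X, starRingEnd ℂ (e k z) * windowedFourier φ f z p‖ₑ ^ 2 =
      ∫⁻ z in X, ‖windowedFourier φ f z p‖ₑ ^ 2 := by
  have hc := (hp.indicator hX).coeFn_toLp
  have h1 : ∀ k, ∫ z in X, starRingEnd ℂ (e k z) * windowedFourier φ f z p =
      ⟪e k, (hp.indicator hX).toLp⟫_ℂ := fun k => by
    rw [L2.inner_def, ← integral_indicator hX]
    refine integral_congr_ae ?_
    filter_upwards [hc] with z hz
    rw [hz]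
    by_cases h : z ∈ X <;> simp [h, mul_comm]
  simp only [h1]
  rw [tsum_enorm_inner_sq, enorm_sq_eq_lintegral, ← lintegral_indicator hX]
  refine lintegral_congr_ae ?_
  filter_upwards [hc] with z hz
  rw [hz]
  by_cases h : z ∈ X <;> simp [h]

variable (ν : Measure ℝ) [IsProbabilityMeasure ν]

lemma measurable_measure_translate (hY : MeasurableSet Y) :
    Measurable fun p : ℝ => ν ((fun t => t + p) ⁻¹' Y) :=
  measurable_measure_prodMk_left (ν := ν) ((measurable_snd.add measurable_fst) hY)

lemma inner_momentumObservable_self (hY : MeasurableSet Y) (f : L2) :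
    ⟪f, momentumObservable ν Y f⟫_ℂ =
      ((∫⁻ p, ν ((fun t => t + p) ⁻¹' Y) * ‖fourierPlancherel f p‖ₑ ^ 2).toReal : ℂ) := by
  have h1 : ⟪f, momentumObservable ν Y f⟫_ℂ =
      ⟪fourierPlancherel f, positionObservable ν Y (fourierPlancherel f)⟫_ℂ := by
    rw [← fourierPlancherel.inner_map_map]
    change ⟪_, fourierPlancherel (fourierPlancherel.symm _)⟫_ℂ = _
    rw [fourierPlancherel.apply_symm_apply]
    rfl
  have h2 : positionObservable ν Y = mulOp _ (memLp_smear ν hY) := by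
    simp [positionObservable, hY]
  have hm : AEStronglyMeasurable (fun p => smear ν Y p * ‖fourierPlancherel f p‖ ^ 2) volume :=
    ((measurable_smear ν hY).mul ((measurable_L2 _).norm.pow_const 2)).aestronglyMeasurable
  rw [h1, h2, inner_mulOp_self, integral_eq_lintegral_of_nonneg_ae
    (.of_forall fun p => mul_nonneg (smear_nonneg ν Y p) (sq_nonneg _)) hm]
  congr 3
  funext p
  rw [ENNReal.ofReal_mul (smear_nonneg ν Y p), ENNReal.ofReal_pow (norm_nonneg _), ofReal_norm,
    smear, ofReal_measureReal]

lemma lintegral_measure_mul_ne_top (Y : Set ℝ) (g : L2) :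
    ∫⁻ p, ν ((fun t => t + p) ⁻¹' Y) * ‖g p‖ₑ ^ 2 ≠ ∞ := by
  refine ne_top_of_le_ne_top (b := ‖g‖ₑ ^ 2) (by simp) ?_
  rw [enorm_sq_eq_lintegral]
  exact lintegral_mono fun p => mul_le_of_le_one_left zero_le prob_le_one

variable [Countable κ] (hφ : ‖φ‖ = 1)
include hφ

/-- Each Kraus term is an integral in momentum space against $\nu(Y-p)$; exchange sum and integral
and use Parseval in $q$ at almost every $p$. Countability of the basis puts all exceptional sets in
one null set. -/
lemma inner_krausDual_momentumObservable (hX : MeasurableSet X) (hY : MeasurableSet Y) (f : L2)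
    (hf : Integrable f) :
    ⟪f, krausDual ((isKrausInstrument e hφ).isKraus hX) (momentumObservable ν Y) f⟫_ℂ =
      ⟪f, phaseOp φ ν (X ×ˢ Y) f⟫_ℂ := by
  rw [inner_krausDual, inner_phaseOp_self, lintegral_phaseWeight_prod φ ν f hY]
  simp only [inner_momentumObservable_self ν hY]
  rw [← Complex.ofReal_tsum, ← ENNReal.tsum_toReal_eq
    fun k => lintegral_measure_mul_ne_top ν Y _]
  congr 2
  have hm : ∀ k, AEMeasurable (fun p => ν ((fun t => t + p) ⁻¹' Y) *
      ‖fourierPlancherel (krausOp φ X (e k) f) p‖ₑ ^ 2) volume := fun k =>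
    ((measurable_measure_translate ν hY).mul
      ((measurable_L2 _).enorm.pow_const 2)).aemeasurable
  rw [← lintegral_tsum hm]
  refine lintegral_congr_ae ?_
  filter_upwards [ae_memLp_windowedFourier φ f,
    ae_all_iff.2 fun k => fourierPlancherel_krausOp (φ := φ) (e k) f hf X] with p hp hk
  rw [ENNReal.tsum_mul_left, ← tsum_enorm_integral_windowedFourier e hX f hp]
  simp only [hk]

/-- Both quadratic forms are continuous in $f$, and Schwartz functions, being integrable, are dense
in $L^2$. -/
lemma krausDual_momentumObservable (hX : MeasurableSet X) (hY : MeasurableSet Y) :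
    krausDual ((isKrausInstrument e hφ).isKraus hX) (momentumObservable ν Y) =
      phaseOp φ ν (X ×ˢ Y) := by
  refine eq_of_forall_inner_self fun f => ?_
  refine DenseRange.induction_on (p := fun f : L2 =>
      ⟪f, krausDual ((isKrausInstrument e hφ).isKraus hX) (momentumObservable ν Y) f⟫_ℂ =
      ⟪f, phaseOp φ ν (X ×ˢ Y) f⟫_ℂ)
    (SchwartzMap.denseRange_toLpCLM (p := 2) ENNReal.ofNat_ne_top) f ?_ fun g => ?_
  · exact isClosed_eq (continuous_id.inner (ContinuousLinearMap.continuous _))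
      (continuous_id.inner (ContinuousLinearMap.continuous _))
  · exact inner_krausDual_momentumObservable e ν hφ hX hY _
      (g.integrable.congr (g.coeFn_toLp 2 volume).symm)

lemma isSequentialJoint_phaseObservable :
    IsSequentialJoint (phiInstrument e hφ) (momentumObservable ν) (phaseObservable ν hφ) := by
  intro X Y hX hY
  rw [phiInstrument_apply e hφ hX, phaseObservable_apply ν hφ (hX.prod hY),
    ← krausDual_momentumObservable e ν hφ hX hY]
  exact isDualImage_krausDual _ _

end Sequential

/-! ### An observable on the plane is determined by rectangles. -/

section Uniqueness

variable {H Ω : Type*} [NormedAddCommGroup H] [InnerProductSpace ℂ H] [CompleteSpace H]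
  [MeasurableSpace Ω]

omit [CompleteSpace H] in
lemma Observable.empty (G : Observable H Ω) : G ∅ = 0 := by
  refine eq_of_forall_inner_self fun f => ?_
  have h := G.hasSum' (fun _ => ∅) (fun _ => MeasurableSet.empty) (fun i j _ => by simp) f f
  rw [zero_apply, inner_zero_right]
  -- A disjoint union of copies of the empty set gives a summable constant series, so its term is
  -- zero.
  exact (summable_const_iff _).1 h.summable

omit [CompleteSpace H] in
lemma Observable.compl (G : Observable H Ω) {Z : Set Ω} (hZ : MeasurableSet Z) :
    G Zᶜ = 1 - G Z := by
  refine eq_of_forall_inner_self fun f => ?_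
  set X : ℕ → Set Ω := fun n => if n = 0 then Z else if n = 1 then Zᶜ else ∅ with hX
  have h0 : X 0 = Z := by simp [hX]
  have h1 : X 1 = Zᶜ := by simp [hX]
  have h2 : ∀ n, X (n + 2) = ∅ := fun n => by simp [hX]
  have hm : ∀ n, MeasurableSet (X n) := fun n => by
    rcases n with - | - | n
    · exact h0 ▸ hZ
    · exact h1 ▸ hZ.compl
    · exact h2 n ▸ MeasurableSet.empty
  have hd : Pairwise fun i j => Disjoint (X i) (X j) := by
    intro i j hij
    rcases i with - | - | i <;> rcases j with - | - | j <;>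
      simp_all [disjoint_compl_left, disjoint_compl_right]
  have hU : ⋃ n, X n = Set.univ :=
    Set.eq_univ_of_forall fun x => by
      by_cases h : x ∈ Z
      · exact Set.mem_iUnion.2 ⟨0, by rwa [h0]⟩
      · exact Set.mem_iUnion.2 ⟨1, by rwa [h1]⟩
  have hs := (G.hasSum' X hm hd f f).unique (hasSum_sum_of_ne_finset_zero (s := Finset.range 2)
    fun n hn => by
      obtain ⟨m, rfl⟩ := Nat.exists_eq_add_of_le' (not_lt.1 (fun h => hn (Finset.mem_range.2 h)))
      rw [h2, G.empty, zero_apply, inner_zero_right])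
  rw [hU, G.univ', Finset.sum_range_succ, Finset.sum_range_one, h0, h1] at hs
  rw [sub_apply, inner_sub_right, hs, add_sub_cancel_left]

omit [CompleteSpace H] in
-- Rectangles form a $\pi$-system generating the Borel sets; agreement passes to complements by
-- normalization and to disjoint unions by weak $\sigma$-additivity.
lemma Observable.ext_prod {G G' : Observable H (ℝ × ℝ)}
    (h : ∀ X Y : Set ℝ, MeasurableSet X → MeasurableSet Y → G (X ×ˢ Y) = G' (X ×ˢ Y)) :
    G = G' := by
  refine Observable.ext (funext fun Z => ?_)
  by_cases hZ : MeasurableSet Z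
  · induction Z, hZ using MeasurableSpace.induction_on_inter generateFrom_prod.symm
      isPiSystem_prod with
    | empty => rw [G.empty, G'.empty]
    | basic Z hZ =>
      obtain ⟨X, hX, Y, hY, rfl⟩ := hZ
      exact h X Y hX hY
    | compl Z hZ ih => rw [G.compl hZ, G'.compl hZ, ih]
    | iUnion Z hd hZ ih =>
      refine eq_of_forall_inner_self fun f => (G.hasSum' Z hZ hd f f).unique ?_
      simp only [ih]
      exact G'.hasSum' Z hZ hd f f
  · rw [G.not_measurable' Z hZ, G'.not_measurable' Z hZ]

lemma IsSequentialJoint.unique {I : Instrument H} {P : Observable H ℝ}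
    {G G' : Observable H (ℝ × ℝ)} (hG : IsSequentialJoint I P G)
    (hG' : IsSequentialJoint I P G') : G = G' :=
  Observable.ext_prod fun X Y hX hY => (hG X Y hX hY).unique (hG' X Y hX hY)

end Uniqueness

end QM

end

theorem mainTheorem9 (φ : QM.L2) (hφ : ‖φ‖ = 1)
    (ν : MeasureTheory.Measure ℝ) [MeasureTheory.IsProbabilityMeasure ν] :
    (∃! I : QM.Instrument QM.L2, QM.IsPhiInstrument φ I) ∧
    ∀ I : QM.Instrument QM.L2, QM.IsPhiInstrument φ I →
      (∃! G : QM.Observable QM.L2 (ℝ × ℝ),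
        QM.IsSequentialJoint I (QM.momentumObservable ν) G) ∧
      QM.IsState (QM.generatingState φ ν) ∧
      ∀ G : QM.Observable QM.L2 (ℝ × ℝ),
        QM.IsSequentialJoint I (QM.momentumObservable ν) G →
          QM.IsCovariantPhaseSpace G ∧ QM.IsGeneratedBy G (QM.generatingState φ ν) := by
  obtain ⟨w, e, hw⟩ := QM.exists_countable_hilbertBasis
  have hI := QM.isPhiInstrument_phiInstrument e hφ
  refine ⟨⟨_, hI, fun J hJ => hJ.unique hI⟩, fun I hI' => ?_⟩
  obtain rfl := hI'.unique hI
  have hG := QM.isSequentialJoint_phaseObservable e ν hφ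
  refine ⟨⟨_, hG, fun G' hG' => hG'.unique hG⟩, QM.isState_generatingState ν hφ, fun G hG' => ?_⟩
  obtain rfl := hG'.unique hG
  exact ⟨QM.isCovariantPhaseSpace_phaseObservable ν hφ, QM.isGeneratedBy_phaseObservable ν hφ⟩
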